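/- Let $\beta>0$ and, for every $n\ge 2$, let $m(n)\ge 1$ be an integer. On a common probability space let, for every $n\ge 2$, $(Z^{(n,0)}_k)_{1\le k\le n}$ be random points of $\mathbb{C}$ with an arbitrary joint law, and let $(\gamma^{(n,j)}_k)_{1\le j\le m(n),\,1\le k\le n}$ be i.i.d. random variables with the Gamma distribution of parameter $\beta/2$ (density $\Gamma(\beta/2)^{-1}x^{\beta/2-1}e^{-x}$ on $x>0$), independent of $(Z^{(n,0)}_k)_{1\le k\le n}$. No assumption is made on the joint law of these families for different $n$. For $1\le j\le m(n)$ define inductively $(Z^{(n,j)}_k)_{1\le k\le n}$ as the (almost surely $n$) zeros, counted with multiplicity, of the polynomial $$z\mapsto\sum_{k=1}^{n}\gamma^{(n,j)}_k\,\bigl(Z^{(n,j-1)}_k+z\bigr)\prod_{1\le \ell\le n,\ \ell\ne k}\bigl(z-Z^{(n,j-1)}_\ell\bigr),$$ numbered in any way that is measurable with respect to $(Z^{(n,0)}_k)_{k}$ and $(\gamma^{(n,i)}_k)_{1\le i\le j,\,1\le k\le n}$. For $0\le j\le m(n)$ let $$\tilde\mu_{n,j}:=\frac1n\sum_{k=1}^{n}\delta_{Z^{(n,j)}_k}.$$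 Assume that, almost surely, $\tilde\mu_{n,0}$ converges weakly, as $n\to\infty$, to a deterministic finite measure $\mu$ on $\mathbb{C}$, that $$\frac{m(n)}{n/\log n}\underset{n\to\infty}{\longrightarrow}0,$$ and that for some $B\ge 0$, $$\sup_{n\ge2}\,n^{-B}\sup_{0\le j\le m(n)-1}\mathbb{E}\Bigl[\min_{1\le k\le n}\bigl|Z^{(n,j)}_k\bigr|\Bigr]<\infty.$$ Then, almost surely, $\tilde\mu_{n,m(n)}$ converges weakly to $\mu$ as $n\to\infty$. -/

import Mathlib

open MeasureTheory ProbabilityTheory Filter Topology Polynomial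
open scoped ENNReal NNReal

/-- The empirical measure `(1/n) ∑ₖ δ_{zₖ}` of `n` complex points, as a finite measure on `ℂ`
(Mathlib's topology on `FiniteMeasure ℂ` is that of weak convergence, i.e. convergence against
all bounded continuous test functions). -/
noncomputable def empiricalMeasure {n : ℕ} (z : Fin n → ℂ) : FiniteMeasure ℂ :=
  (n : ℝ≥0)⁻¹ • ∑ k, (diracProba (z k)).toFiniteMeasure

/-- The circular randomized derivative with weights `c` of the polynomial with zeros `z`:
`∑ₖ cₖ (zₖ + X) ∏_{ℓ ≠ k} (X - z_ℓ)`. -/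
noncomputable def circularDeriv {n : ℕ} (c : Fin n → ℝ) (z : Fin n → ℂ) : ℂ[X] :=
  ∑ k, C (c k : ℂ) * (C (z k) + X) * ∏ l ∈ Finset.univ.erase k, (X - C (z l))

/-- The information available after `j` iterations: the σ-algebra generated by the initial points
`Z₀` and by the weights of the iterations `1, …, j`. The weights of the `i`-th iteration,
`1 ≤ i ≤ M`, are `γ (i - 1)`. -/
@[reducible] noncomputable def stepHistory {Ω : Type*} {n M : ℕ}
    (Z₀ : Fin n → Ω → ℂ) (γ : Fin M → Fin n → Ω → ℝ) (j : ℕ) :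
    MeasurableSpace Ω :=
  (⨆ k, MeasurableSpace.comap (Z₀ k) inferInstance) ⊔
    ⨆ (i : Fin M) (_ : i.val < j) (k : Fin n), MeasurableSpace.comap (γ i k) inferInstance

/-- `Z 0, Z 1, …, Z M` are the successive families of `n` random points obtained from the random
points `Z 0` by `M` iterations of the circular randomized derivative, with weights
`γ 0, …, γ (M - 1)`, where the weights are i.i.d. with the Gamma distribution of parameter `β / 2`
(density proportional to `x ^ (β / 2 - 1) * exp (-x)` on the positive half-line) and independent of
the initial points. The zeros at step `j` may be numbered in any way which is measurable with
respect to the information available after `j` iterations. -/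
structure IsCircularIteration {Ω : Type*} [MeasurableSpace Ω] (P : Measure Ω) (β : ℝ) (n M : ℕ)
    (Z : Fin (M + 1) → Fin n → Ω → ℂ) (γ : Fin M → Fin n → Ω → ℝ) : Prop where
  measurable_initial : ∀ k, Measurable (Z 0 k)
  measurable_weight : ∀ j k, Measurable (γ j k)
  law_weight : ∀ j k, HasLaw (γ j k) (gammaMeasure (β / 2) 1) P
  indep_weights : iIndepFun (fun (p : Fin M × Fin n) => γ p.1 p.2) P
  indep_initial : IndepFun (fun ω k => Z 0 k ω) (fun ω (p : Fin M × Fin n) => γ p.1 p.2 ω) P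
  adapted : ∀ (j : Fin (M + 1)) (k : Fin n), Measurable[stepHistory (Z 0) γ j] (Z j k)
  zeros : ∀ᵐ ω ∂P, ∀ j : Fin M,
    Multiset.map (fun k => Z j.succ k ω) Finset.univ.val =
      (circularDeriv (fun k => γ j k ω) (fun k => Z j.castSucc k ω)).roots

/-! Weak limits are read off from the truncated potentials U_j(c, r) = ∑ₖ log max(r, |z_k - c|), z_k
being the points after j iterations. By Jensen's formula U_j(c, r) is the mean of log ∏ₖ |u - z_k|
over the circle |u - c| = r. One iteration therefore changes it by the circle mean of log |S(u)| -
log ∑ₖ γ_k, where S(u) = ∑ₖ γ_k (u + z_k)/(u - z_k). It suffices that m(n) iterations change it by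
O(m(n) log n) = o(n), almost surely for fixed (c, r).

The upper bound is deterministic: (u + z)/(u - z) = -1 + 2u/(u - z), the function |u - z|^(-1/2) has
a circle mean bounded uniformly in z, and Jensen's inequality with exponent 1/2 costs 2 log(1 + A n)
per step (`exists_sum_log_max_sub_le`).

For the lower bound, write S = a_k (γ_k + b_k) with a_k = (u + z_k)/(u - z_k) and k the index of a
point of polynomial size. The mean of log |a_k| is then at least -O(log n). Since b_k does not
involve γ_k, a small negative moment of |γ_k + b_k| is bounded uniformly in the past and in the
other weights. Summing over k (`stepMoment`) makes the random choice of k harmless; multiplying over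
the steps and conditioning successively gives expectation at most (K n)^M
(`lintegral_prod_stepMoment_le`), and Jensen's inequality on the circle turns this into the lower
bound (`le_sum_log_max_sub`).

Markov's inequality gives exceptional events of probability O(n⁻²), so Borel–Cantelli applies
whatever the coupling between different n. Differences of potentials at two radii are integrals of
radial bumps, and countably many bumps determine weak convergence
(`tendsto_of_forall_tendsto_integral_logBump`). -/

/-! ### Moments of the Gamma law -/

theorem setLIntegral_enorm_rpow_neg_half_lt_top (a : ℝ) :
    ∫⁻ x in Set.Icc (-a) a, ‖x‖ₑ ^ (-(1 / 2) : ℝ) < ∞ := by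
  have h : IntegrableOn (fun x : ℝ => |x| ^ (-(1 / 2) : ℝ)) (Set.Icc 0 a) := by
    rcases le_or_gt a 0 with ha | ha
    · have : volume (Set.Icc 0 a) = 0 := by
        rw [Real.volume_Icc]; simpa using ha
      rw [IntegrableOn, Measure.restrict_eq_zero.2 this]; exact integrable_zero_measure
    · have := (intervalIntegral.intervalIntegrable_rpow' (a := 0) (b := a)
        (r := -(1 / 2)) (by norm_num)).1
      refine ((integrableOn_Icc_iff_integrableOn_Ioc).2 this).congr_fun ?_ measurableSet_Icc
      intro x hx
      simp [abs_of_nonneg hx.1]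
  have h' : IntegrableOn (fun x : ℝ => |x| ^ (-(1 / 2) : ℝ)) (Set.Icc (-a) 0) := by
    have := h.comp_neg
    simpa using this
  have h2 : IntegrableOn (fun x : ℝ => |x| ^ (-(1 / 2) : ℝ)) (Set.Icc (-a) a) :=
    (h'.union h).mono_set fun x hx => by
      rcases le_total x 0 with h0 | h0
      · exact Or.inl ⟨hx.1, h0⟩
      · exact Or.inr ⟨h0, hx.2⟩
  refine lt_of_eq_of_lt (lintegral_congr_ae ?_) h2.2
  have : ∀ᵐ x : ℝ ∂(volume.restrict (Set.Icc (-a) a)), x ≠ 0 :=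
    ae_restrict_of_ae (by simp [ae_iff])
  filter_upwards [this] with x hx
  rw [Real.enorm_eq_ofReal_abs x, Real.enorm_of_nonneg (Real.rpow_nonneg (abs_nonneg x) _),
    ENNReal.ofReal_rpow_of_pos (abs_pos.2 hx)]

/-- With p = 1 + s/2 the singularity at 0 is x^((s-1)p), and (s-1)p + 1 = s(s+1)/2 > 0; since
exp(-px) ≤ exp(-x), the power is dominated by a multiple of another Gamma density. For s < 1 the
density is unbounded, so integrability with some p > 1 replaces a sup bound. -/
theorem lintegral_gammaPDF_rpow_lt_top {s : ℝ} (hs : 0 < s) :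
    ∫⁻ x, gammaPDF s 1 x ^ (1 + s / 2) < ∞ := by
  set p : ℝ := 1 + s / 2 with hp
  have hp0 : 0 < p := by positivity
  set q : ℝ := (s - 1) * p + 1 with hq
  have hq0 : 0 < q := by rw [hq, hp]; nlinarith
  have hG := Real.Gamma_pos_of_pos hs
  have key : ∀ x : ℝ, 0 < x → gammaPDF s 1 x ^ p ≤
      ENNReal.ofReal ((1 / Real.Gamma s) ^ p * Real.Gamma q) * gammaPDF q 1 x := by
    intro x hx
    rw [gammaPDF_of_nonneg hx.le, gammaPDF_of_nonneg hx.le, ENNReal.ofReal_rpow_of_pos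
      (by positivity), ← ENNReal.ofReal_mul (by have := Real.Gamma_pos_of_pos hq0; positivity)]
    refine ENNReal.ofReal_le_ofReal ?_
    have hGq := Real.Gamma_pos_of_pos hq0
    rw [Real.one_rpow, Real.one_rpow, Real.mul_rpow (by positivity) (by positivity),
      Real.mul_rpow (by positivity) (by positivity), ← Real.rpow_mul hx.le]
    have e1 : Real.exp (-(1 * x)) ^ p ≤ Real.exp (-(1 * x)) := by
      rw [← Real.exp_mul]
      refine Real.exp_le_exp.2 ?_
      rw [hp]; nlinarith [mul_pos hx hs]
    have e2 : x ^ (q - 1) = x ^ ((s - 1) * p) := by rw [hq]; ring_nf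
    rw [e2]
    calc (1 / Real.Gamma s) ^ p * x ^ ((s - 1) * p) * Real.exp (-(1 * x)) ^ p
        ≤ (1 / Real.Gamma s) ^ p * x ^ ((s - 1) * p) * Real.exp (-(1 * x)) := by gcongr
      _ = _ := by field_simp
  have key' : ∀ᵐ x : ℝ, gammaPDF s 1 x ^ p ≤
      ENNReal.ofReal ((1 / Real.Gamma s) ^ p * Real.Gamma q) * gammaPDF q 1 x := by
    have : ∀ᵐ x : ℝ, x ≠ 0 := by simp [ae_iff]
    filter_upwards [this] with x hx
    rcases lt_or_gt_of_ne hx with h | h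
    · simp [gammaPDF_of_neg h, hp0]
    · exact key x h
  refine (lintegral_mono_ae key').trans_lt ?_
  rw [lintegral_const_mul' _ _ ENNReal.ofReal_ne_top, lintegral_gammaPDF_eq_one hq0 one_pos]
  simp

theorem measurable_gammaPDF (a r : ℝ) : Measurable (gammaPDF a r) :=
  (measurable_gammaPDFReal a r).ennreal_ofReal

/-- Negative moments of small order of a translated Gamma variable are bounded uniformly in the
translation. -/
theorem exists_lintegral_gammaMeasure_enorm_add_rpow_le {s : ℝ} (hs : 0 < s) :
    ∃ C : ℝ≥0∞, C ≠ ∞ ∧ ∀ b : ℂ,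
      ∫⁻ x, ‖(x : ℂ) + b‖ₑ ^ (-(s / (2 * (s + 2)))) ∂(gammaMeasure s 1) ≤ C := by
  set c : ℝ := s / (2 * (s + 2)) with hc
  have hc0 : 0 < c := by positivity
  -- The density lies in L^p, q is the conjugate exponent, and c is tuned so that c q = 1/2: the
  -- q-th power of |x|^(-c) is then locally integrable.
  set p : ℝ := 1 + s / 2 with hp
  set q : ℝ := (s + 2) / s with hq
  have hpq : p.HolderConjugate q := by
    rw [Real.holderConjugate_iff]
    constructor
    · rw [hp]; linarith
    · rw [hp, hq]; field_simp; ring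
  have hcq : c * q = 1 / 2 := by rw [hc, hq]; field_simp
  refine ⟨1 + ((∫⁻ x, gammaPDF s 1 x ^ p) / ENNReal.ofReal p +
    (∫⁻ x in Set.Icc (-1 : ℝ) 1, ‖x‖ₑ ^ (-(1 / 2) : ℝ)) / ENNReal.ofReal q), ?_, ?_⟩
  · have h1 := lintegral_gammaPDF_rpow_lt_top hs
    have h2 := setLIntegral_enorm_rpow_neg_half_lt_top 1
    have h3 : ENNReal.ofReal p ≠ 0 := by simpa using hpq.pos
    have h4 : ENNReal.ofReal q ≠ 0 := by simpa using hpq.symm.pos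
    exact ENNReal.add_ne_top.2 ⟨ENNReal.one_ne_top, ENNReal.add_ne_top.2
      ⟨ENNReal.div_ne_top h1.ne h3, ENNReal.div_ne_top h2.ne h4⟩⟩
  · intro b
    have hb : ∀ x : ℝ, ‖(x : ℂ) + b‖ₑ ^ (-c) ≤ ‖x + b.re‖ₑ ^ (-c) := by
      intro x
      rw [ENNReal.rpow_neg, ENNReal.rpow_neg]
      gcongr
      rw [← ofReal_norm, ← ofReal_norm]
      refine ENNReal.ofReal_le_ofReal ?_
      simpa using Complex.abs_re_le_norm ((x : ℂ) + b)
    rw [gammaMeasure, lintegral_withDensity_eq_lintegral_mul _ (measurable_gammaPDF s 1)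
      (by fun_prop)]
    set I : Set ℝ := Set.Icc (-1) 1
    have hpt : ∀ x : ℝ, (gammaPDF s 1 * fun x : ℝ => ‖(x : ℂ) + b‖ₑ ^ (-c)) x ≤
        gammaPDF s 1 x + (gammaPDF s 1 x ^ p / ENNReal.ofReal p +
          I.indicator (fun y : ℝ => ‖y‖ₑ ^ (-(1 / 2) : ℝ)) (x + b.re) / ENNReal.ofReal q) := by
      intro x
      simp only [Pi.mul_apply]
      refine (mul_le_mul_right (hb x) _).trans ?_
      -- Near the singularity Young's inequality separates the density from the negative power; away
      -- from it the power is at most 1. Translation invariance of Lebesgue measure later removes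
      -- the dependence on b.
      by_cases hx : x + b.re ∈ I
      · refine le_trans ?_ le_add_self
        rw [Set.indicator_of_mem hx]
        refine (ENNReal.young_inequality _ _ hpq).trans_eq ?_
        rw [← ENNReal.rpow_mul]
        congr 4
        linarith
      · refine le_trans ?_ le_self_add
        have h1 : (1 : ℝ≥0∞) ≤ ‖x + b.re‖ₑ := by
          rw [Real.enorm_eq_ofReal_abs, ← ENNReal.ofReal_one]
          refine ENNReal.ofReal_le_ofReal ?_
          by_contra! h
          exact hx (abs_le.1 h.le)
        have h2 : ‖x + b.re‖ₑ ^ (-c) ≤ 1 := by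
          rw [ENNReal.rpow_neg]
          exact ENNReal.inv_le_one.2 (ENNReal.one_le_rpow h1 hc0)
        calc _ ≤ gammaPDF s 1 x * 1 := by gcongr
          _ = _ := mul_one _
    refine (lintegral_mono hpt).trans ?_
    have hm := measurable_gammaPDF s 1
    have hI : Measurable (I.indicator fun y : ℝ => ‖y‖ₑ ^ (-(1 / 2) : ℝ)) :=
      Measurable.indicator (by fun_prop) measurableSet_Icc
    have hshift := lintegral_add_right_eq_self (μ := volume)
      (I.indicator fun y : ℝ => ‖y‖ₑ ^ (-(1 / 2) : ℝ)) b.re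
    simp only [ENNReal.div_eq_inv_mul]
    rw [lintegral_add_left hm, lintegral_gammaPDF_eq_one hs one_pos,
      lintegral_add_left ((hm.pow_const p).const_mul _), lintegral_const_mul _ (hm.pow_const p),
      lintegral_const_mul _ (show Measurable fun x => I.indicator
        (fun y : ℝ => ‖y‖ₑ ^ (-(1 / 2) : ℝ)) (x + b.re) from hI.comp (measurable_add_const _)), hshift,
      lintegral_indicator measurableSet_Icc]

theorem ae_pos_gammaMeasure (s : ℝ) : ∀ᵐ x ∂(gammaMeasure s 1), 0 < x := by
  rw [gammaMeasure, ae_withDensity_iff (measurable_gammaPDF s 1)]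
  have : ∀ᵐ x : ℝ, x ≠ 0 := by simp [ae_iff]
  filter_upwards [this] with x hx h
  by_contra! hle
  exact h (gammaPDF_of_neg (lt_of_le_of_ne hle hx))

theorem lintegral_enorm_gammaMeasure_lt_top {s : ℝ} (hs : 0 < s) :
    ∫⁻ x, ‖x‖ₑ ∂(gammaMeasure s 1) < ∞ := by
  have hs1 : 0 < s + 1 := by linarith
  have hm := measurable_gammaPDF s 1
  rw [gammaMeasure, lintegral_withDensity_eq_lintegral_mul _ hm (by fun_prop)]
  have key : ∀ᵐ x : ℝ, (gammaPDF s 1 * fun x : ℝ => ‖x‖ₑ) x ≤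
      ENNReal.ofReal (1 / Real.Gamma s * Real.Gamma (s + 1)) * gammaPDF (s + 1) 1 x := by
    have : ∀ᵐ x : ℝ, x ≠ 0 := by simp [ae_iff]
    filter_upwards [this] with x hx
    simp only [Pi.mul_apply]
    rcases lt_or_gt_of_ne hx with h | h
    · simp [gammaPDF_of_neg h]
    · have hG := Real.Gamma_pos_of_pos hs
      have hG1 := Real.Gamma_pos_of_pos hs1
      rw [gammaPDF_of_nonneg h.le, gammaPDF_of_nonneg h.le, Real.enorm_of_nonneg h.le,
        ← ENNReal.ofReal_mul (by positivity), ← ENNReal.ofReal_mul (by positivity)]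
      refine le_of_eq (congrArg _ ?_)
      rw [show s + 1 - 1 = s - 1 + 1 by ring, Real.rpow_add_one h.ne' (s - 1)]
      simp only [Real.one_rpow]
      field_simp
  refine (lintegral_mono_ae key).trans_lt ?_
  rw [lintegral_const_mul' _ _ ENNReal.ofReal_ne_top, lintegral_gammaPDF_eq_one hs1 one_pos]
  simp

/-! ### Integrating out an independent variable -/

/-- The hypotheses make the law of the triple a product of three laws, and rebracketing the product
gives the claim. It serves to detach one weight from the initial points together with the other
weights. -/
theorem ProbabilityTheory.IndepFun.prodMk_of_indepFun {Ω α β δ : Type*} [MeasurableSpace Ω]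
    [MeasurableSpace α] [MeasurableSpace β] [MeasurableSpace δ] {P : Measure Ω}
    [IsProbabilityMeasure P] {X : Ω → α} {Y : Ω → β} {W : Ω → δ}
    (hX : Measurable X) (hY : Measurable Y) (hW : Measurable W)
    (h : IndepFun X (fun ω => (Y ω, W ω)) P) (h' : IndepFun Y W P) :
    IndepFun (fun ω => (X ω, Y ω)) W P := by
  have hXY : IndepFun X Y P := h.comp measurable_id measurable_fst
  have := Measure.isProbabilityMeasure_map (μ := P) hX.aemeasurable
  have := Measure.isProbabilityMeasure_map (μ := P) hY.aemeasurable
  have := Measure.isProbabilityMeasure_map (μ := P) hW.aemeasurable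
  rw [indepFun_iff_map_prod_eq_prod_map_map (hX.prodMk hY).aemeasurable hW.aemeasurable]
  rw [indepFun_iff_map_prod_eq_prod_map_map hX.aemeasurable (hY.prodMk hW).aemeasurable] at h
  rw [indepFun_iff_map_prod_eq_prod_map_map hY.aemeasurable hW.aemeasurable] at h'
  rw [indepFun_iff_map_prod_eq_prod_map_map hX.aemeasurable hY.aemeasurable] at hXY
  rw [hXY, ← MeasurePreserving.map_eq (measurePreserving_prodAssoc (P.map X) (P.map Y)
    (P.map W)).symm, ← h', ← h, Measure.map_map (MeasurableEquiv.measurable _)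
    (hX.prodMk (hY.prodMk hW))]
  rfl

/-- Integrating out an independent variable whose translates have bounded negative moments. -/
theorem lintegral_mul_enorm_add_rpow_le {Ω α : Type*} [MeasurableSpace Ω]
    [MeasurableSpace α] {P : Measure Ω} [IsProbabilityMeasure P] {X : Ω → α} {Y : Ω → ℝ}
    (hX : Measurable X) (hY : Measurable Y) (h : IndepFun X Y P)
    {A : Ω → ℝ≥0∞} {b : Ω → ℂ} (hA : Measurable[MeasurableSpace.comap X inferInstance] A)
    (hb : Measurable[MeasurableSpace.comap X inferInstance] b) {e : ℝ} {K : ℝ≥0∞}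
    (hK : ∀ b : ℂ, ∫⁻ y, ‖(y : ℂ) + b‖ₑ ^ e ∂(P.map Y) ≤ K) :
    ∫⁻ ω, A ω * ‖(Y ω : ℂ) + b ω‖ₑ ^ e ∂P ≤ K * ∫⁻ ω, A ω ∂P := by
  obtain ⟨A', hA', rfl⟩ := hA.exists_eq_measurable_comp
  obtain ⟨b', hb', rfl⟩ := hb.exists_eq_measurable_comp
  have := Measure.isProbabilityMeasure_map (μ := P) hX.aemeasurable
  have := Measure.isProbabilityMeasure_map (μ := P) hY.aemeasurable
  rw [indepFun_iff_map_prod_eq_prod_map_map hX.aemeasurable hY.aemeasurable] at h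
  have hF : Measurable fun q : α × ℝ => A' q.1 * ‖(q.2 : ℂ) + b' q.1‖ₑ ^ e := by fun_prop
  calc ∫⁻ ω, (A' ∘ X) ω * ‖(Y ω : ℂ) + (b' ∘ X) ω‖ₑ ^ e ∂P
      = ∫⁻ q, A' q.1 * ‖(q.2 : ℂ) + b' q.1‖ₑ ^ e ∂(P.map fun ω => (X ω, Y ω)) := by
        rw [lintegral_map hF (hX.prodMk hY)]; rfl
    _ = ∫⁻ x, A' x * ∫⁻ y, ‖(y : ℂ) + b' x‖ₑ ^ e ∂(P.map Y) ∂(P.map X) := by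
        rw [h, lintegral_prod _ hF.aemeasurable]
        refine lintegral_congr fun x => ?_
        exact lintegral_const_mul (A' x) (f := fun y : ℝ => ‖(y : ℂ) + b' x‖ₑ ^ e) (by fun_prop)
    _ ≤ ∫⁻ x, A' x * K ∂(P.map X) := by gcongr; exact hK _
    _ = _ := by rw [lintegral_mul_const _ hA', lintegral_map hA' hX, mul_comm]; rfl

/-! ### Means over circles -/

/-- The uniform probability measure on the circle of centre `c` and radius `r`. -/
noncomputable def circleUniform (c : ℂ) (r : ℝ) : Measure ℂ :=
  ENNReal.ofReal (2 * Real.pi)⁻¹ •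
    (volume.restrict (Set.Ioc 0 (2 * Real.pi))).map (circleMap c r)

instance isProbabilityMeasure_circleUniform (c : ℂ) (r : ℝ) :
    IsProbabilityMeasure (circleUniform c r) where
  measure_univ := by
    have hm : Measurable (circleMap c r) := (continuous_circleMap c r).measurable
    have hpi := Real.pi_pos
    rw [circleUniform, Measure.smul_apply, Measure.map_apply hm MeasurableSet.univ]
    simp only [Set.preimage_univ, Measure.restrict_apply MeasurableSet.univ, Set.univ_inter,
      Real.volume_Ioc, smul_eq_mul, sub_zero]
    rw [← ENNReal.ofReal_mul (by positivity), inv_mul_cancel₀ (by positivity), ENNReal.ofReal_one]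

theorem ae_ne_circleUniform (c w : ℂ) {r : ℝ} (hr : r ≠ 0) :
    ∀ᵐ u ∂(circleUniform c r), u ≠ w := by
  have hm : Measurable (circleMap c r) := (continuous_circleMap c r).measurable
  refine Measure.ae_smul_measure ?_ _
  rw [ae_map_iff hm.aemeasurable (by measurability)]
  refine ae_restrict_of_ae ?_
  have := ((Set.countable_singleton w).preimage_circleMap c hr).ae_notMem volume
  filter_upwards [this] with θ hθ h
  exact hθ h

theorem ae_mem_sphere_circleUniform (c : ℂ) {r : ℝ} (hr : 0 < r) :
    ∀ᵐ u ∂(circleUniform c r), ‖u - c‖ = r := by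
  have hm : Measurable (circleMap c r) := (continuous_circleMap c r).measurable
  refine Measure.ae_smul_measure ?_ _
  rw [ae_map_iff hm.aemeasurable (measurableSet_eq_fun (by fun_prop) (by fun_prop))]
  refine ae_of_all _ fun θ => ?_
  simp [circleMap, abs_of_pos hr]

theorem integrable_circleUniform_iff {c : ℂ} {r : ℝ} {f : ℂ → ℝ} (hf : Measurable f) :
    Integrable f (circleUniform c r) ↔ CircleIntegrable f c r := by
  have hm : Measurable (circleMap c r) := (continuous_circleMap c r).measurable
  have hpi := Real.pi_pos
  rw [circleUniform, integrable_smul_measure (by simp; positivity) ENNReal.ofReal_ne_top,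
    integrable_map_measure hf.aestronglyMeasurable hm.aemeasurable, CircleIntegrable,
    intervalIntegrable_iff_integrableOn_Ioc_of_le (by positivity)]
  rfl

theorem integral_circleUniform {c : ℂ} {r : ℝ} {f : ℂ → ℝ} (hf : Measurable f) :
    ∫ u, f u ∂(circleUniform c r) = Real.circleAverage f c r := by
  have hm : Measurable (circleMap c r) := (continuous_circleMap c r).measurable
  have hpi := Real.pi_pos
  rw [circleUniform, integral_smul_measure, integral_map hm.aemeasurable hf.aestronglyMeasurable,
    Real.circleAverage, intervalIntegral.integral_of_le (by positivity),
    ENNReal.toReal_ofReal (by positivity)]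

theorem integrable_log_norm_sub_circleUniform (c w : ℂ) (r : ℝ) :
    Integrable (fun u => Real.log ‖u - w‖) (circleUniform c r) :=
  (integrable_circleUniform_iff (by fun_prop)).2 (circleIntegrable_log_norm_sub_const r)

/-- Jensen's formula for a polynomial of degree one; this is where truncated potentials come from.
-/
theorem integral_log_norm_sub_circleUniform (c w : ℂ) {r : ℝ} (hr : 0 < r) :
    ∫ u, Real.log ‖u - w‖ ∂(circleUniform c r) = Real.log (max r ‖w - c‖) := by
  rw [integral_circleUniform (by fun_prop),
    circleAverage_log_norm_sub_const_eq_log_radius_add_posLog hr.ne', Real.posLog_eq_log_max_one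
      (by positivity), ← Real.log_mul hr.ne' (by positivity), mul_max_of_nonneg _ _ hr.le,
    norm_sub_rev, mul_inv_cancel_left₀ hr.ne', mul_one]

/-- By π-periodicity only the zero at 0 matters, and there |sin x| ≥ (2/π)|x|. -/
theorem intervalIntegrable_abs_sin_rpow_neg_half (a b : ℝ) :
    IntervalIntegrable (fun x => |Real.sin x| ^ (-(1 / 2) : ℝ)) volume a b := by
  have hper : Function.Periodic (fun x => |Real.sin x| ^ (-(1 / 2) : ℝ)) Real.pi := by
    intro x; simp
  have hpi := Real.pi_pos
  refine hper.intervalIntegrable (t := -(Real.pi / 2)) hpi.ne' ?_ a b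
  rw [show -(Real.pi / 2) + Real.pi = Real.pi / 2 by ring,
    intervalIntegrable_iff_integrableOn_Icc_of_le (by linarith)]
  refine ⟨(show Measurable fun x => |Real.sin x| ^ (-(1 / 2) : ℝ) by
    fun_prop).aestronglyMeasurable, ?_⟩
  have hC := setLIntegral_enorm_rpow_neg_half_lt_top (Real.pi / 2)
  have : ∀ᵐ x ∂(volume.restrict (Set.Icc (-(Real.pi / 2)) (Real.pi / 2))),
      ‖|Real.sin x| ^ (-(1 / 2) : ℝ)‖ₑ ≤
        ENNReal.ofReal ((2 / Real.pi) ^ (-(1 / 2) : ℝ)) * ‖x‖ₑ ^ (-(1 / 2) : ℝ) := by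
    have h0 : ∀ᵐ x : ℝ, x ≠ 0 := by simp [ae_iff]
    filter_upwards [ae_restrict_of_ae h0, ae_restrict_mem measurableSet_Icc] with x hx hx'
    have hx0 : 0 < |x| := abs_pos.2 hx
    have h1 := Real.mul_abs_le_abs_sin (abs_le.2 hx')
    rw [Real.enorm_eq_ofReal_abs x, ENNReal.ofReal_rpow_of_pos hx0,
      ← ENNReal.ofReal_mul (by positivity), ← Real.mul_rpow (by positivity) hx0.le,
      Real.enorm_of_nonneg (by positivity)]
    refine ENNReal.ofReal_le_ofReal ?_
    exact Real.rpow_le_rpow_of_nonpos (by positivity) h1 (by norm_num)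
  refine (lintegral_mono_ae this).trans_lt ?_
  rw [lintegral_const_mul' _ _ ENNReal.ofReal_ne_top]
  exact ENNReal.mul_lt_top ENNReal.ofReal_lt_top hC

/-- The distance from a point of a circle to a point of fixed argument. -/
theorem exists_mul_abs_sin_le_norm_circleMap_sub (c w : ℂ) {r : ℝ} (hr : 0 < r) :
    ∃ α : ℝ, ∀ θ : ℝ, r * |Real.sin (θ - α)| ≤ ‖circleMap c r θ - w‖ := by
  refine ⟨(w - c).arg, fun θ => ?_⟩
  set α := (w - c).arg with hα
  -- After rotating by the argument of w - c, the difference becomes r e^(i(θ-α)) - |w - c|, whose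
  -- imaginary part r sin(θ - α) no longer involves |w - c|.
  have h1 : circleMap c r θ - w =
      Complex.exp (α * Complex.I) * (r * Complex.exp (((θ - α : ℝ) : ℂ) * Complex.I) - ‖w - c‖) := by
    have h2 := Complex.norm_mul_exp_arg_mul_I (w - c)
    rw [← hα] at h2
    have h3 : Complex.exp (θ * Complex.I) =
        Complex.exp (α * Complex.I) * Complex.exp (((θ - α : ℝ) : ℂ) * Complex.I) := by
      rw [← Complex.exp_add]; congr 1; push_cast; ring
    rw [circleMap, h3]
    linear_combination h2
  rw [h1, norm_mul, Complex.norm_exp_ofReal_mul_I, one_mul]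
  refine le_trans (le_of_eq ?_) (Complex.abs_im_le_norm _)
  rw [Complex.exp_mul_I, ← Complex.ofReal_cos, ← Complex.ofReal_sin]
  simp [-Complex.ofReal_sub, -Complex.ofReal_cos, -Complex.ofReal_sin, abs_mul, abs_of_pos hr]

/-- The inverse square root of the distance to a point is integrable on circles, uniformly in the
point. -/
theorem exists_integral_norm_sub_rpow_circleUniform_le (c : ℂ) {r : ℝ} (hr : 0 < r) :
    ∃ C : ℝ, ∀ w : ℂ, Integrable (fun u => ‖u - w‖ ^ (-(1 / 2) : ℝ)) (circleUniform c r) ∧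
      ∫ u, ‖u - w‖ ^ (-(1 / 2) : ℝ) ∂(circleUniform c r) ≤ C := by
  have hpi := Real.pi_pos
  set h : ℝ → ℝ := fun x => |Real.sin x| ^ (-(1 / 2) : ℝ) with hh
  have hper : Function.Periodic h (2 * Real.pi) := by
    intro x; simp [hh]
  refine ⟨(2 * Real.pi)⁻¹ * (r ^ (-(1 / 2) : ℝ) * ∫ x in 0..(2 * Real.pi), h x), fun w => ?_⟩
  obtain ⟨α, hα⟩ := exists_mul_abs_sin_le_norm_circleMap_sub c w hr
  have hsin : ∀ᵐ θ : ℝ, Real.sin (θ - α) ≠ 0 := by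
    have hc : {θ : ℝ | Real.sin (θ - α) = 0}.Countable := by
      refine Set.Countable.mono (s₂ := Set.range fun k : ℤ => k * Real.pi + α) ?_
        (Set.countable_range _)
      intro θ hθ
      obtain ⟨k, hk⟩ := Real.sin_eq_zero_iff.1 hθ
      exact ⟨k, by simp only; linarith⟩
    exact hc.ae_notMem volume
  have hpt : ∀ᵐ θ : ℝ, ‖circleMap c r θ - w‖ ^ (-(1 / 2) : ℝ) ≤
      r ^ (-(1 / 2) : ℝ) * h (θ - α) := by
    filter_upwards [hsin] with θ hθ
    rw [hh, ← Real.mul_rpow hr.le (abs_nonneg _)]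
    exact Real.rpow_le_rpow_of_nonpos (mul_pos hr (abs_pos.2 hθ)) (hα θ) (by norm_num)
  have hI : IntervalIntegrable (fun θ => r ^ (-(1 / 2) : ℝ) * h (θ - α)) volume 0
      (2 * Real.pi) := by
    refine IntervalIntegrable.const_mul ?_ _
    have := (intervalIntegrable_abs_sin_rpow_neg_half (0 - α) (2 * Real.pi - α)).comp_sub_right α
    simpa [hh] using this
  have hm : Measurable (circleMap c r) := (continuous_circleMap c r).measurable
  have hI' : IntervalIntegrable (fun θ => ‖circleMap c r θ - w‖ ^ (-(1 / 2) : ℝ)) volume 0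
      (2 * Real.pi) := by
    refine hI.mono_fun (show Measurable fun θ => ‖circleMap c r θ - w‖ ^ (-(1 / 2) : ℝ) by
      fun_prop).aestronglyMeasurable ?_
    filter_upwards [ae_restrict_of_ae hpt] with θ hθ
    rw [Real.norm_of_nonneg (by positivity), Real.norm_of_nonneg (by positivity)]
    exact hθ
  refine ⟨(integrable_circleUniform_iff (by fun_prop)).2 hI', ?_⟩
  rw [integral_circleUniform (by fun_prop), Real.circleAverage, smul_eq_mul]
  gcongr
  refine (intervalIntegral.integral_mono_ae (by positivity) hI' hI hpt).trans_eq ?_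
  rw [intervalIntegral.integral_const_mul, intervalIntegral.integral_comp_sub_right h α]
  congr 1
  have := hper.intervalIntegral_add_eq (0 - α) 0
  rw [zero_add] at this
  rw [← this]
  congr 1
  ring

/-! ### The circular derivative and its logarithm -/

section circularDeriv

variable {n : ℕ} {c : Fin n → ℝ} {z : Fin n → ℂ}

theorem eval_circularDeriv {u : ℂ} (hu : ∀ k, u ≠ z k) :
    (circularDeriv c z).eval u = (∑ k, c k * ((u + z k) / (u - z k))) * ∏ l, (u - z l) := by
  rw [circularDeriv, eval_finsetSum, Finset.sum_mul]
  refine Finset.sum_congr rfl fun k _ => ?_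
  have h := sub_ne_zero.2 (hu k)
  rw [← Finset.mul_prod_erase Finset.univ _ (Finset.mem_univ k)]
  simp only [eval_mul, eval_C, eval_add, eval_X, eval_prod, eval_sub]
  field_simp
  ring

theorem monic_circularDeriv_term (z : Fin n → ℂ) (k : Fin n) :
    ((C (z k) + X) * ∏ l ∈ Finset.univ.erase k, (X - C (z l))).Monic ∧
    ((C (z k) + X) * ∏ l ∈ Finset.univ.erase k, (X - C (z l))).natDegree = n := by
  have h1 : (C (z k) + X).Monic := by rw [add_comm]; exact monic_X_add_C _
  have h2 : (∏ l ∈ Finset.univ.erase k, (X - C (z l))).Monic :=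
    monic_prod_of_monic _ _ fun l _ => monic_X_sub_C _
  refine ⟨h1.mul h2, ?_⟩
  rw [h1.natDegree_mul h2, natDegree_prod_of_monic _ _ fun l _ => monic_X_sub_C _, add_comm (C _),
    natDegree_X_add_C]
  simp
  have := k.2
  omega

/-- Each summand is its weight times a monic polynomial of degree n, so the leading coefficient is
the total weight and no degree is lost. -/
theorem circularDeriv_eq_prod {z' : Fin n → ℂ} (hc : (∑ k, c k) ≠ 0)
    (hz' : Multiset.map z' Finset.univ.val = (circularDeriv c z).roots) :
    circularDeriv c z = C ((∑ k, c k : ℝ) : ℂ) * ∏ l, (X - C (z' l)) := by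
  set p := circularDeriv c z with hp
  have hterm : ∀ k, (C (c k : ℂ) * (C (z k) + X) * ∏ l ∈ Finset.univ.erase k, (X - C (z l))) =
      C (c k : ℂ) * ((C (z k) + X) * ∏ l ∈ Finset.univ.erase k, (X - C (z l))) := fun k => by ring
  have hcoeff : p.coeff n = ((∑ k, c k : ℝ) : ℂ) := by
    rw [hp, circularDeriv, finsetSum_coeff, Complex.ofReal_sum]
    refine Finset.sum_congr rfl fun k _ => ?_
    rw [hterm, coeff_C_mul]
    obtain ⟨h1, h2⟩ := monic_circularDeriv_term z k
    have := h1.coeff_natDegree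
    rw [h2] at this
    rw [this, mul_one]
  have hdeg : p.natDegree ≤ n := by
    rw [hp, circularDeriv]
    refine natDegree_sum_le_of_forall_le _ _ fun k _ => ?_
    rw [hterm]
    exact (natDegree_C_mul_le _ _).trans (monic_circularDeriv_term z k).2.le
  have hne : p.coeff n ≠ 0 := by
    rw [hcoeff]; exact_mod_cast hc
  have hdeg' : p.natDegree = n := le_antisymm hdeg (le_natDegree_of_ne_zero hne)
  have hsplit := (IsAlgClosed.splits p).eq_prod_roots
  rw [hsplit, ← hz', leadingCoeff, hdeg', hcoeff, Multiset.map_map]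
  rfl

/-- Evaluate the polynomial at u both as a weighted sum and as a product over its roots, then take
logarithms: the weighted sum carries exactly the increment of the untruncated potential. -/
theorem log_norm_sum_eq_of_roots_circularDeriv {z' : Fin n → ℂ} (hc : 0 < ∑ k, c k)
    (hz' : Multiset.map z' Finset.univ.val = (circularDeriv c z).roots)
    {u : ℂ} (hu : ∀ k, u ≠ z k) (hu' : ∀ k, u ≠ z' k) :
    0 < ‖∑ k, c k * ((u + z k) / (u - z k))‖ ∧
    Real.log ‖∑ k, c k * ((u + z k) / (u - z k))‖ =
      Real.log (∑ k, c k) + (∑ k, Real.log ‖u - z' k‖ - ∑ k, Real.log ‖u - z k‖) := by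
  have h1 := eval_circularDeriv (c := c) hu
  rw [circularDeriv_eq_prod hc.ne' hz', eval_mul, eval_C, eval_prod] at h1
  simp only [eval_sub, eval_X, eval_C] at h1
  have h2 := congrArg norm h1
  rw [norm_mul, norm_mul, norm_prod, norm_prod, Complex.norm_of_nonneg hc.le] at h2
  have hn : ∀ k, ‖u - z k‖ ≠ 0 := fun k => norm_ne_zero_iff.2 (sub_ne_zero.2 (hu k))
  have hn' : ∀ k, ‖u - z' k‖ ≠ 0 := fun k => norm_ne_zero_iff.2 (sub_ne_zero.2 (hu' k))
  have hp : ∏ k, ‖u - z k‖ ≠ 0 := Finset.prod_ne_zero_iff.2 fun k _ => hn k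
  have hp' : ∏ k, ‖u - z' k‖ ≠ 0 := Finset.prod_ne_zero_iff.2 fun k _ => hn' k
  have hS : ‖∑ k, c k * ((u + z k) / (u - z k))‖ ≠ 0 := by
    intro h
    rw [h, zero_mul] at h2
    exact mul_ne_zero hc.ne' hp' h2
  refine ⟨lt_of_le_of_ne (norm_nonneg _) (Ne.symm hS), ?_⟩
  have h3 := congrArg Real.log h2
  rw [Real.log_mul hc.ne' hp', Real.log_mul hS hp, Real.log_prod fun k _ => hn' k,
    Real.log_prod fun k _ => hn k] at h3
  linarith

/-- Writing (u + z)/(u - z) = -1 + 2u/(u - z) gives a bound that does not grow with z. It is stated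
as a square because |u - z|^(-1/2), unlike |u - z|⁻¹, has circle means bounded uniformly in z. -/
theorem norm_sum_le_of_circularDeriv (hc : ∀ k, 0 ≤ c k) {u : ℂ} (hu : ∀ k, u ≠ z k) {R : ℝ}
    (hR : ‖u‖ ≤ R) :
    ‖∑ k, c k * ((u + z k) / (u - z k))‖ ≤
      (∑ k, c k) * (1 + √(2 * R) * ∑ k, ‖u - z k‖ ^ (-(1 / 2) : ℝ)) ^ 2 := by
  have hR0 : 0 ≤ R := (norm_nonneg u).trans hR
  set x : Fin n → ℝ := fun k => ‖u - z k‖ ^ (-(1 / 2) : ℝ) with hx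
  have hx0 : ∀ k, 0 ≤ x k := fun k => by positivity
  refine (norm_sum_le _ _).trans ?_
  rw [Finset.sum_mul]
  refine Finset.sum_le_sum fun k _ => ?_
  rw [norm_mul, Complex.norm_of_nonneg (hc k)]
  refine mul_le_mul_of_nonneg_left ?_ (hc k)
  have hne := sub_ne_zero.2 (hu k)
  have hpos : 0 < ‖u - z k‖ := norm_pos_iff.2 hne
  have h1 : (u + z k) / (u - z k) = -1 + 2 * u / (u - z k) := by field_simp; ring
  have hxk : x k ^ 2 = ‖u - z k‖⁻¹ := by
    rw [hx, ← Real.rpow_natCast, ← Real.rpow_mul hpos.le, ← Real.rpow_neg_one]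
    norm_num
  have hle : x k ≤ ∑ l, x l := Finset.single_le_sum (fun l _ => hx0 l) (Finset.mem_univ k)
  have hsq : √(2 * R) ^ 2 = 2 * R := Real.sq_sqrt (by positivity)
  calc ‖(u + z k) / (u - z k)‖ ≤ 1 + 2 * R * x k ^ 2 := by
        rw [h1, hxk]
        refine (norm_add_le _ _).trans ?_
        rw [norm_neg, norm_one, norm_div, norm_mul, Complex.norm_ofNat, div_eq_mul_inv]
        gcongr
    _ = 1 + (√(2 * R) * x k) ^ 2 := by rw [mul_pow, hsq]
    _ ≤ (1 + √(2 * R) * x k) ^ 2 := by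
        nlinarith [mul_nonneg (Real.sqrt_nonneg (2 * R)) (hx0 k)]
    _ ≤ _ := by have := hx0 k; gcongr

end circularDeriv

/-! ### Increments of the potential -/

/-- Jensen's inequality for the exponential, obtained by integrating log t ≤ t - 1 at t = exp(f)/K.
-/
theorem integral_le_log_of_lintegral_exp_le {α : Type*} [MeasurableSpace α] {ν : Measure α}
    [IsProbabilityMeasure ν] {f : α → ℝ} (hf : Integrable f ν) {K : ℝ} (hK : 0 < K)
    (h : ∫⁻ u, ENNReal.ofReal (Real.exp (f u)) ∂ν ≤ ENNReal.ofReal K) :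
    ∫ u, f u ∂ν ≤ Real.log K := by
  have hm : AEStronglyMeasurable (fun u => Real.exp (f u)) ν :=
    Real.continuous_exp.comp_aestronglyMeasurable hf.1
  have hE : Integrable (fun u => Real.exp (f u)) ν := by
    refine ⟨hm, ?_⟩
    rw [hasFiniteIntegral_iff_ofReal (ae_of_all _ fun u => (Real.exp_pos _).le)]
    exact h.trans_lt ENNReal.ofReal_lt_top
  have hEK : ∫ u, Real.exp (f u) ∂ν ≤ K := by
    rw [integral_eq_lintegral_of_nonneg_ae (ae_of_all _ fun u => (Real.exp_pos _).le) hm]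
    exact ENNReal.toReal_le_of_le_ofReal hK.le h
  have hpt : ∀ u, f u ≤ Real.exp (f u) / K + (Real.log K - 1) := fun u => by
    have := Real.log_le_sub_one_of_pos (div_pos (Real.exp_pos (f u)) hK)
    rw [Real.log_div (Real.exp_pos _).ne' hK.ne', Real.log_exp] at this
    linarith
  have hR : Integrable (fun u => Real.exp (f u) / K + (Real.log K - 1)) ν :=
    (hE.div_const K).add (integrable_const _)
  refine (integral_mono hf hR hpt).trans ?_
  rw [integral_add (hE.div_const K) (integrable_const _), integral_div]
  have : (∫ u, Real.exp (f u) ∂ν) / K ≤ 1 := (div_le_one hK).2 hEK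
  simp only [integral_const, probReal_univ, smul_eq_mul, one_mul]
  linarith

theorem integral_log_sum_sub_log_sum_circleUniform {n : ℕ} (z z' : Fin n → ℂ) (c : ℂ) {r : ℝ}
    (hr : 0 < r) :
    Integrable (fun u => ∑ k, Real.log ‖u - z' k‖ - ∑ k, Real.log ‖u - z k‖) (circleUniform c r) ∧
    ∫ u, (∑ k, Real.log ‖u - z' k‖ - ∑ k, Real.log ‖u - z k‖) ∂(circleUniform c r) =
      ∑ k, Real.log (max r ‖z' k - c‖) - ∑ k, Real.log (max r ‖z k - c‖) := by
  have h1 : ∀ w : Fin n → ℂ, Integrable (fun u => ∑ k, Real.log ‖u - w k‖) (circleUniform c r) :=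
    fun w => integrable_finsetSum _ fun k _ => integrable_log_norm_sub_circleUniform c (w k) r
  have h2 : ∀ w : Fin n → ℂ, ∫ u, ∑ k, Real.log ‖u - w k‖ ∂(circleUniform c r) =
      ∑ k, Real.log (max r ‖w k - c‖) := fun w => by
    rw [integral_finsetSum _ fun k _ => integrable_log_norm_sub_circleUniform c (w k) r]
    simp only [integral_log_norm_sub_circleUniform c _ hr]
  refine ⟨(h1 z').sub (h1 z), ?_⟩
  rw [integral_sub (h1 z') (h1 z), h2, h2]

/-- One step of the circular randomized derivative increases the potential, averaged on a circle,
by at most a logarithm of the degree. -/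
theorem exists_sum_log_max_sub_le (c : ℂ) {r : ℝ} (hr : 0 < r) :
    ∃ A : ℝ, 0 < A ∧ ∀ (n : ℕ) (w : Fin n → ℝ) (z z' : Fin n → ℂ), (∀ k, 0 < w k) → 0 < n →
      Multiset.map z' Finset.univ.val = (circularDeriv w z).roots →
      ∑ k, Real.log (max r ‖z' k - c‖) - ∑ k, Real.log (max r ‖z k - c‖) ≤
        2 * Real.log (1 + A * n) := by
  obtain ⟨B, hB⟩ := exists_integral_norm_sub_rpow_circleUniform_le c hr
  set R : ℝ := ‖c‖ + r with hR
  have hR0 : 0 ≤ R := by positivity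
  set A : ℝ := √(2 * R) * (|B| + 1) with hA
  have hA0 : 0 < A := by positivity
  refine ⟨A, hA0, fun n w z z' hw hn hz => ?_⟩
  have : Nonempty (Fin n) := ⟨⟨0, hn⟩⟩
  have hW : 0 < ∑ k, w k := Finset.sum_pos (fun k _ => hw k) Finset.univ_nonempty
  obtain ⟨hint, heq⟩ := integral_log_sum_sub_log_sum_circleUniform z z' c hr
  rw [← heq]
  set Y : ℂ → ℝ := fun u => 1 + √(2 * R) * ∑ k, ‖u - z k‖ ^ (-(1 / 2) : ℝ) with hY
  have hS : Integrable (fun u => ∑ k, ‖u - z k‖ ^ (-(1 / 2) : ℝ)) (circleUniform c r) :=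
    integrable_finsetSum _ fun k _ => (hB (z k)).1
  have hYi : Integrable Y (circleUniform c r) := (integrable_const 1).add (hS.const_mul _)
  set K : ℝ := 1 + A * n with hK
  have hK0 : 0 < K := by positivity
  have hYK : ∫ u, Y u ∂(circleUniform c r) ≤ K := by
    rw [hY, integral_add (integrable_const 1) (hS.const_mul _), integral_const_mul,
      integral_finsetSum _ fun k _ => (hB (z k)).1]
    have : ∑ k, ∫ u, ‖u - z k‖ ^ (-(1 / 2) : ℝ) ∂(circleUniform c r) ≤
        ∑ _k : Fin n, (|B| + 1) :=
      Finset.sum_le_sum fun k _ => (hB (z k)).2.trans ((le_abs_self B).trans (by linarith))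
    simp only [Finset.sum_const, Finset.card_univ, Fintype.card_fin, nsmul_eq_mul] at this
    have h2 := mul_le_mul_of_nonneg_left this (Real.sqrt_nonneg (2 * R))
    simp only [integral_const, probReal_univ, smul_eq_mul, mul_one]
    rw [hK, hA]
    linarith
  have hY0 : ∀ u, 0 < Y u := fun u => by
    have : 0 ≤ ∑ k, ‖u - z k‖ ^ (-(1 / 2) : ℝ) := Finset.sum_nonneg fun k _ => by positivity
    positivity
  -- The factor 1/2 undoes the square in `norm_sum_le_of_circularDeriv`, and the total weight
  -- cancels.
  have hpt : ∀ᵐ u ∂(circleUniform c r),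
      Real.exp (1 / 2 * (∑ k, Real.log ‖u - z' k‖ - ∑ k, Real.log ‖u - z k‖)) ≤ Y u := by
    filter_upwards [ae_all_iff.2 fun k => ae_ne_circleUniform c (z k) hr.ne',
      ae_all_iff.2 fun k => ae_ne_circleUniform c (z' k) hr.ne',
      ae_mem_sphere_circleUniform c hr] with u hu hu' hc
    obtain ⟨h1, h2⟩ := log_norm_sum_eq_of_roots_circularDeriv hW hz hu hu'
    have huR : ‖u‖ ≤ R := by
      calc ‖u‖ = ‖c + (u - c)‖ := by ring_nf
        _ ≤ ‖c‖ + ‖u - c‖ := norm_add_le _ _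
        _ = R := by rw [hc]
    have h3 := norm_sum_le_of_circularDeriv (fun k => (hw k).le) hu huR
    have h4 := Real.log_le_log h1 h3
    rw [Real.log_mul hW.ne' (pow_ne_zero 2 (hY0 u).ne'), Real.log_pow] at h4
    rw [← Real.le_log_iff_exp_le (hY0 u)]
    push_cast at h4
    linarith
  have hle : ∫⁻ u, ENNReal.ofReal (Real.exp (1 / 2 *
      (∑ k, Real.log ‖u - z' k‖ - ∑ k, Real.log ‖u - z k‖))) ∂(circleUniform c r) ≤
        ENNReal.ofReal K := by
    refine (lintegral_mono_ae (hpt.mono fun u hu => ENNReal.ofReal_le_ofReal hu)).trans ?_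
    rw [← ofReal_integral_eq_lintegral_ofReal hYi (ae_of_all _ fun u => (hY0 u).le)]
    exact ENNReal.ofReal_le_ofReal hYK
  have := integral_le_log_of_lintegral_exp_le (hint.const_mul _) hK0 hle
  rw [integral_const_mul] at this
  linarith

/-- The sum over `k` of negative powers of the randomized logarithmic derivative, normalized by its
`k`-th summand. -/
noncomputable def stepMoment {n : ℕ} (e : ℝ) (w : Fin n → ℝ) (z : Fin n → ℂ) (u : ℂ) : ℝ≥0∞ :=
  ∑ k, ‖(w k : ℂ) + (∑ l ∈ Finset.univ.erase k, w l * ((u + z l) / (u - z l))) /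
    ((u + z k) / (u - z k))‖ₑ ^ (-e)

/-- The left side is exactly the k-th summand. Bounding it by the whole sum removes k, which will be
chosen depending on the configuration. -/
theorem ofReal_exp_le_stepMoment {n : ℕ} {e : ℝ} {w : Fin n → ℝ} {z : Fin n → ℂ} {u : ℂ}
    (k : Fin n) (hu : u ≠ z k) (hu' : u ≠ -z k)
    (hS : 0 < ‖∑ k, w k * ((u + z k) / (u - z k))‖) :
    ENNReal.ofReal (Real.exp (e * (Real.log ‖u - -z k‖ - Real.log ‖u - z k‖ -
      Real.log ‖∑ k, w k * ((u + z k) / (u - z k))‖))) ≤ stepMoment e w z u := by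
  refine le_trans (le_of_eq ?_) (Finset.single_le_sum (fun k _ => zero_le) (Finset.mem_univ k))
  have h1 : u - z k ≠ 0 := sub_ne_zero.2 hu
  have h2 : u + z k ≠ 0 := fun h => hu' (eq_neg_of_add_eq_zero_left h)
  have ha : (u + z k) / (u - z k) ≠ 0 := div_ne_zero h2 h1
  have h3 : (w k : ℂ) + (∑ l ∈ Finset.univ.erase k, w l * ((u + z l) / (u - z l))) /
      ((u + z k) / (u - z k)) =
      (∑ k, w k * ((u + z k) / (u - z k))) / ((u + z k) / (u - z k)) := by
    rw [← Finset.add_sum_erase Finset.univ (fun k => w k * ((u + z k) / (u - z k)))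
      (Finset.mem_univ k), add_div _ _ ((u + z k) / (u - z k)), mul_div_cancel_right₀ _ ha]
  have h4 : 0 < ‖u - z k‖ := norm_pos_iff.2 h1
  have h5 : 0 < ‖u + z k‖ := norm_pos_iff.2 h2
  rw [h3, ← ofReal_norm, norm_div, norm_div, ENNReal.ofReal_rpow_of_pos (by positivity),
    Real.rpow_def_of_pos (by positivity), Real.log_div hS.ne' (by positivity),
    Real.log_div h5.ne' h4.ne', sub_neg_eq_add]
  congr 2
  ring

theorem Fin.sum_succ_sub_castSucc {M : ℕ} (g : Fin (M + 1) → ℝ) :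
    ∑ j : Fin M, (g j.succ - g j.castSucc) = g (Fin.last M) - g 0 := by
  have h1 := Fin.sum_univ_succ g
  have h2 := Fin.sum_univ_castSucc g
  rw [Finset.sum_sub_distrib]
  linarith

/-- Successive steps of the circular randomized derivative cannot decrease much the potential,
averaged on a circle, if one of the points is not too large at each step and if the negative moment
of the steps is controlled. -/
theorem le_sum_log_max_sub {n M : ℕ} (c : ℂ) {r : ℝ} (hr : 0 < r) {w : Fin M → Fin n → ℝ}
    {z : Fin (M + 1) → Fin n → ℂ} (hw : ∀ j k, 0 < w j k)
    (hz : ∀ j : Fin M, Multiset.map (z j.succ) Finset.univ.val =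
      (circularDeriv (w j) (z j.castSucc)).roots)
    {ρ G K e : ℝ} (k : Fin M → Fin n) (hk : ∀ j, ‖z j.castSucc (k j)‖ ≤ ρ)
    (hG : ∀ j, ∑ l, w j l ≤ G) (he : 0 < e) (hK : 0 < K)
    (hV : ∫⁻ u, ∏ j, stepMoment e (w j) (z j.castSucc) u ∂(circleUniform c r) ≤
      ENNReal.ofReal K) :
    M * (Real.log r - Real.log (max r (ρ + ‖c‖)) - Real.log G) - Real.log K / e ≤
      ∑ l, Real.log (max r ‖z (Fin.last M) l - c‖) - ∑ l, Real.log (max r ‖z 0 l - c‖) := by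
  set L : Fin M → ℂ → ℝ := fun j u =>
    ∑ l, Real.log ‖u - z j.succ l‖ - ∑ l, Real.log ‖u - z j.castSucc l‖ with hL
  set g : Fin (M + 1) → ℝ := fun j => ∑ l, Real.log (max r ‖z j l - c‖) with hg
  have hLi : ∀ j, Integrable (L j) (circleUniform c r) ∧
      ∫ u, L j u ∂(circleUniform c r) = g j.succ - g j.castSucc := fun j =>
    integral_log_sum_sub_log_sum_circleUniform _ _ c hr
  have hsum : ∀ j, 0 < ∑ l, w j l := fun j =>
    Finset.sum_pos (fun l _ => hw j l) ⟨k j, Finset.mem_univ _⟩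
  -- Almost everywhere on the circle, F j is minus the logarithm of the step's weighted sum divided
  -- by its term of index k j.
  set F : Fin M → ℂ → ℝ := fun j u => Real.log ‖u - -z j.castSucc (k j)‖ -
    Real.log ‖u - z j.castSucc (k j)‖ - (Real.log (∑ l, w j l) + L j u) with hF
  have hi := fun v => integrable_log_norm_sub_circleUniform c v r
  have hFi : ∀ j, Integrable (F j) (circleUniform c r) := fun j =>
    ((hi _).sub (hi _)).sub ((integrable_const _).add (hLi j).1)
  have hFe : ∀ j, Real.log r - Real.log (max r (ρ + ‖c‖)) - Real.log G -
      (g j.succ - g j.castSucc) ≤ ∫ u, F j u ∂(circleUniform c r) := fun j => by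
    have : ∫ u, F j u ∂(circleUniform c r) =
        Real.log (max r ‖-z j.castSucc (k j) - c‖) - Real.log (max r ‖z j.castSucc (k j) - c‖) -
          (Real.log (∑ l, w j l) + (g j.succ - g j.castSucc)) := by
      have h1 : Integrable (fun u => Real.log ‖u - -z j.castSucc (k j)‖ -
          Real.log ‖u - z j.castSucc (k j)‖) (circleUniform c r) := (hi _).sub (hi _)
      have h2 : Integrable (fun u => Real.log (∑ l, w j l) + L j u) (circleUniform c r) :=
        (integrable_const _).add (hLi j).1
      simp only [hF]
      rw [integral_sub h1 h2, integral_sub (hi _) (hi _), integral_add (integrable_const _) (hLi j).1, (hLi j).2,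
        integral_log_norm_sub_circleUniform c _ hr, integral_log_norm_sub_circleUniform c _ hr]
      simp
    rw [this]
    -- Truncation at r keeps the mean of log |u + z| from being very negative, while the size bound
    -- ρ controls the mean of log |u - z|.
    have h1 : Real.log r ≤ Real.log (max r ‖-z j.castSucc (k j) - c‖) :=
      Real.log_le_log hr (le_max_left _ _)
    have h2 : Real.log (max r ‖z j.castSucc (k j) - c‖) ≤ Real.log (max r (ρ + ‖c‖)) := by
      refine Real.log_le_log (by positivity) (max_le_max le_rfl ?_)
      exact (norm_sub_le _ _).trans (by linarith [hk j])
    have h3 : Real.log (∑ l, w j l) ≤ Real.log G := Real.log_le_log (hsum j) (hG j)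
    linarith
  have hle : ∫⁻ u, ENNReal.ofReal (Real.exp (e * ∑ j, F j u)) ∂(circleUniform c r) ≤
      ENNReal.ofReal K := by
    refine le_trans (lintegral_mono_ae ?_) hV
    filter_upwards [ae_all_iff.2 fun j => ae_all_iff.2 fun l =>
        ae_ne_circleUniform c (z j l) hr.ne',
      ae_all_iff.2 fun j => ae_all_iff.2 fun l =>
        ae_ne_circleUniform c (-z j l) hr.ne'] with u hu hu'
    rw [Finset.mul_sum, Real.exp_sum, ENNReal.ofReal_prod_of_nonneg fun j _ => (Real.exp_pos _).le]
    refine Finset.prod_le_prod' fun j _ => ?_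
    obtain ⟨h1, h2⟩ := log_norm_sum_eq_of_roots_circularDeriv (hsum j) (hz j) (hu j.castSucc)
      (hu j.succ)
    have := ofReal_exp_le_stepMoment (e := e) (k j) (hu j.castSucc (k j)) (hu' j.castSucc (k j)) h1
    rwa [h2] at this
  have hlog := integral_le_log_of_lintegral_exp_le
    ((integrable_finsetSum Finset.univ fun j _ => hFi j).const_mul e) hK hle
  rw [integral_const_mul, integral_finsetSum _ fun j _ => hFi j, mul_comm, ← le_div_iff₀ he] at hlog
  have hs := (Finset.sum_le_sum fun j (_ : j ∈ Finset.univ) => hFe j).trans hlog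
  rw [Finset.sum_sub_distrib, Fin.sum_succ_sub_castSucc] at hs
  simp only [Finset.sum_const, Finset.card_univ, Fintype.card_fin, nsmul_eq_mul] at hs
  linarith

/-- Upper bound for the potential after several steps, averaged on a circle. -/
theorem exists_sum_log_max_sub_le_mul (c : ℂ) {r : ℝ} (hr : 0 < r) :
    ∃ A : ℝ, 0 < A ∧ ∀ (n M : ℕ) (w : Fin M → Fin n → ℝ) (z : Fin (M + 1) → Fin n → ℂ),
      (∀ j k, 0 < w j k) → 0 < n →
      (∀ j : Fin M, Multiset.map (z j.succ) Finset.univ.val =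
        (circularDeriv (w j) (z j.castSucc)).roots) →
      ∑ l, Real.log (max r ‖z (Fin.last M) l - c‖) - ∑ l, Real.log (max r ‖z 0 l - c‖) ≤
        M * (2 * Real.log (1 + A * n)) := by
  obtain ⟨A, hA, h⟩ := exists_sum_log_max_sub_le c hr
  refine ⟨A, hA, fun n M w z hw hn hz => ?_⟩
  rw [← Fin.sum_succ_sub_castSucc fun j => ∑ l, Real.log (max r ‖z j l - c‖)]
  refine (Finset.sum_le_sum fun j _ => h n (w j) _ _ (hw j) hn (hz j)).trans ?_
  simp

/-! ### From potentials to weak convergence -/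

/-- A radial bump function: constant on the closed ball of radius `r`, zero outside the open ball of
radius `R`. -/
noncomputable def logBump (c : ℂ) (r R : ℝ) (w : ℂ) : ℝ :=
  Real.log (max R ‖w - c‖) - Real.log (max r ‖w - c‖)

theorem continuous_logBump (c : ℂ) {r R : ℝ} (hr : 0 < r) (hR : 0 < R) :
    Continuous (logBump c r R) := by
  have : ∀ {s : ℝ}, 0 < s → Continuous fun w : ℂ => Real.log (max s ‖w - c‖) := fun {s} hs =>
    Continuous.log (by fun_prop) fun w => (lt_max_of_lt_left hs).ne'
  exact (this hR).sub (this hr)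

theorem logBump_nonneg (c w : ℂ) {r R : ℝ} (hr : 0 < r) (hrR : r ≤ R) : 0 ≤ logBump c r R w :=
  sub_nonneg.2 (Real.log_le_log (lt_max_of_lt_left hr) (max_le_max hrR le_rfl))

theorem logBump_le (c w : ℂ) {r R : ℝ} (hr : 0 < r) (hrR : r ≤ R) :
    logBump c r R w ≤ Real.log (R / r) := by
  have hR := hr.trans_le hrR
  rw [logBump, Real.log_div hR.ne' hr.ne']
  rcases le_total ‖w - c‖ R with h | h
  · rw [max_eq_left h]
    have := Real.log_le_log hr (le_max_left r ‖w - c‖)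
    linarith
  · rw [max_eq_right h, max_eq_right (hrR.trans h), sub_self]
    have := Real.log_le_log hr hrR
    linarith

theorem logBump_of_le {c w : ℂ} {r R : ℝ} (hr : 0 < r) (hrR : r ≤ R) (h : ‖w - c‖ ≤ r) :
    logBump c r R w = Real.log (R / r) := by
  rw [logBump, max_eq_left h, max_eq_left (h.trans hrR),
    Real.log_div (hr.trans_le hrR).ne' hr.ne']

theorem logBump_of_ge {c w : ℂ} {r R : ℝ} (hrR : r ≤ R) (h : R ≤ ‖w - c‖) :
    logBump c r R w = 0 := by
  rw [logBump, max_eq_right h, max_eq_right (hrR.trans h), sub_self]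

/-- Divided by log(R/r), a bump centred near x lies between the indicators of the two balls. -/
theorem measure_closedBall_le_liminf_of_tendsto_logBump {μ : ProbabilityMeasure ℂ}
    {μs : ℕ → ProbabilityMeasure ℂ} {D : Set ℂ} (hD : Dense D)
    (h : ∀ c ∈ D, ∀ r R : ℚ, 0 < r → r < R →
      Tendsto (fun n => ∫ w, logBump c r R w ∂(μs n : Measure ℂ)) atTop
        (𝓝 (∫ w, logBump c r R w ∂(μ : Measure ℂ))))
    (x : ℂ) {ρ ρ' : ℝ} (hρ : 0 ≤ ρ) (hρ' : ρ < ρ') :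
    (μ : Measure ℂ) (Metric.closedBall x ρ) ≤
      liminf (fun n => (μs n : Measure ℂ) (Metric.ball x ρ')) atTop := by
  -- With |c - x| < δ and ρ + δ < r < ρ + 2δ < R < ρ + 3δ, the ball of radius ρ at x lies inside
  -- that of radius r at c, and the ball of radius R at c inside that of radius ρ' = ρ + 4δ at x.
  set δ : ℝ := (ρ' - ρ) / 4 with hδ
  have hδ0 : 0 < δ := by rw [hδ]; linarith
  obtain ⟨c, hcD, hc⟩ := hD.exists_dist_lt x hδ0
  obtain ⟨r, hr1, hr2⟩ := exists_rat_btwn (show ρ + δ < ρ + 2 * δ by linarith)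
  obtain ⟨R, hR1, hR2⟩ := exists_rat_btwn (show ρ + 2 * δ < ρ + 3 * δ by linarith)
  have hr0 : (0 : ℝ) < r := by linarith
  have hrR : (r : ℝ) < R := by linarith
  have hR0 : (0 : ℝ) < R := by linarith
  set l : ℝ := Real.log (R / r) with hl
  have hl0 : 0 < l := Real.log_pos ((one_lt_div hr0).2 hrR)
  have hcont := continuous_logBump c hr0 hR0
  have hnn : ∀ w, 0 ≤ logBump c r R w := fun w => logBump_nonneg c w hr0 hrR.le
  have hint : ∀ ν : ProbabilityMeasure ℂ, Integrable (logBump c r R) (ν : Measure ℂ) := fun ν =>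
    Integrable.of_bound hcont.aestronglyMeasurable l (ae_of_all _ fun w => by
      rw [Real.norm_of_nonneg (hnn w)]; exact logBump_le c w hr0 hrR.le)
  have hlow : (μ : Measure ℂ) (Metric.closedBall x ρ) ≤
      ENNReal.ofReal ((∫ w, logBump c r R w ∂(μ : Measure ℂ)) / l) := by
    rw [← integral_div, ofReal_integral_eq_lintegral_ofReal ((hint μ).div_const l)
      (ae_of_all _ fun w => div_nonneg (hnn w) hl0.le),
      ← lintegral_indicator_one measurableSet_closedBall]
    refine lintegral_mono fun w => ?_
    by_cases hw : w ∈ Metric.closedBall x ρ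
    · rw [Set.indicator_of_mem hw, logBump_of_le hr0 hrR.le, div_self hl0.ne']
      · simp
      · rw [← dist_eq_norm]
        have := dist_triangle w x c
        rw [Metric.mem_closedBall] at hw
        linarith
    · rw [Set.indicator_of_notMem hw]; exact zero_le
  have hup : ∀ n, ENNReal.ofReal ((∫ w, logBump c r R w ∂(μs n : Measure ℂ)) / l) ≤
      (μs n : Measure ℂ) (Metric.ball x ρ') := fun n => by
    rw [← integral_div, ofReal_integral_eq_lintegral_ofReal ((hint (μs n)).div_const l)
      (ae_of_all _ fun w => div_nonneg (hnn w) hl0.le),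
      ← lintegral_indicator_one measurableSet_ball]
    refine lintegral_mono fun w => ?_
    by_cases hw : w ∈ Metric.ball x ρ'
    · rw [Set.indicator_of_mem hw, Pi.one_apply, ← ENNReal.ofReal_one]
      exact ENNReal.ofReal_le_ofReal ((div_le_one hl0).2 (logBump_le c w hr0 hrR.le))
    · rw [logBump_of_ge hrR.le, zero_div, ENNReal.ofReal_zero]
      · exact zero_le
      · rw [← dist_eq_norm]
        have := dist_triangle w c x
        rw [Metric.mem_ball, not_lt] at hw
        rw [dist_comm c x] at this
        linarith
  have hlim : Tendsto
      (fun n => ENNReal.ofReal ((∫ w, logBump c r R w ∂(μs n : Measure ℂ)) / l)) atTop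
      (𝓝 (ENNReal.ofReal ((∫ w, logBump c r R w ∂(μ : Measure ℂ)) / l))) :=
    ENNReal.tendsto_ofReal ((h c hcD r R (by exact_mod_cast hr0) (by exact_mod_cast hrR)).div_const l)
  calc _ ≤ _ := hlow
    _ = liminf (fun n => ENNReal.ofReal ((∫ w, logBump c r R w ∂(μs n : Measure ℂ)) / l)) atTop :=
        hlim.liminf_eq.symm
    _ ≤ _ := liminf_le_liminf (Eventually.of_forall hup)

/-- Radial logarithmic bump functions, with centre in a dense set and rational radii, determine the
weak convergence of probability measures on the complex plane. -/
theorem tendsto_of_forall_tendsto_integral_logBump {μ : ProbabilityMeasure ℂ}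
    {μs : ℕ → ProbabilityMeasure ℂ} {D : Set ℂ} (hD : Dense D)
    (h : ∀ c ∈ D, ∀ r R : ℚ, 0 < r → r < R →
      Tendsto (fun n => ∫ w, logBump c r R w ∂(μs n : Measure ℂ)) atTop
        (𝓝 (∫ w, logBump c r R w ∂(μ : Measure ℂ)))) :
    Tendsto μs atTop (𝓝 μ) := by
  refine tendsto_of_forall_isOpen_le_liminf' fun G hG => ?_
  -- When the sphere is null, continuity from below along smaller radii allows ρ' = ρ.
  have hball : ∀ (x : ℂ) {ρ : ℝ}, 0 < ρ → (μ : Measure ℂ) (Metric.sphere x ρ) = 0 →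
      (μ : Measure ℂ) (Metric.closedBall x ρ) ≤
        liminf (fun n => (μs n : Measure ℂ) (Metric.ball x ρ)) atTop := by
    intro x ρ hρ h0
    have hsub : Metric.closedBall x ρ ⊆
        Metric.sphere x ρ ∪ ⋃ k : ℕ, Metric.closedBall x (ρ - ρ / (k + 1)) := by
      intro w hw
      rcases (Metric.mem_closedBall.1 hw).lt_or_eq with hlt | heq
      · refine Or.inr (Set.mem_iUnion.2 ?_)
        obtain ⟨k, hk⟩ := exists_nat_one_div_lt (div_pos (sub_pos.2 hlt) hρ)
        refine ⟨k, Metric.mem_closedBall.2 ?_⟩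
        rw [lt_div_iff₀ hρ] at hk
        have : ρ / (k + 1) = 1 / (k + 1) * ρ := by ring
        linarith
      · exact Or.inl heq
    have hmono : Monotone fun k : ℕ => Metric.closedBall x (ρ - ρ / (k + 1)) := by
      intro a b hab
      refine Metric.closedBall_subset_closedBall ?_
      have : (a : ℝ) ≤ b := by exact_mod_cast hab
      gcongr
    calc (μ : Measure ℂ) (Metric.closedBall x ρ)
        ≤ (μ : Measure ℂ) (Metric.sphere x ρ) +
          (μ : Measure ℂ) (⋃ k : ℕ, Metric.closedBall x (ρ - ρ / (k + 1))) :=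
          (measure_mono hsub).trans (measure_union_le _ _)
      _ = ⨆ k : ℕ, (μ : Measure ℂ) (Metric.closedBall x (ρ - ρ / (k + 1))) := by
          rw [h0, zero_add, hmono.measure_iUnion]
      _ ≤ _ := iSup_le fun k => by
          have h1 : ρ / ((k : ℝ) + 1) ≤ ρ := div_le_self hρ.le (by linarith [k.cast_nonneg (α := ℝ)])
          have h2 : 0 < ρ / ((k : ℝ) + 1) := by positivity
          exact measure_closedBall_le_liminf_of_tendsto_logBump hD h x (by linarith) (by linarith)
  -- Besicovitch's theorem fills μ-almost all of G with disjoint closed balls contained in G and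
  -- having null spheres; Fatou's lemma for counting measure then sums the estimates over the balls.
  obtain ⟨t, r, ht, htG, htr, hcov, hdisj⟩ := Besicovitch.exists_disjoint_closedBall_covering_ae
    (μ : Measure ℂ) (fun x => {ρ | Metric.closedBall x ρ ⊆ G ∧
      (μ : Measure ℂ) (Metric.sphere x ρ) = 0}) G
    (fun x hx δ hδ => by
      obtain ⟨ε, hε, hεG⟩ := Metric.isOpen_iff.1 hG x hx
      obtain ⟨ρ, hρ, h0⟩ := exists_null_frontier_thickening (μ : Measure ℂ) {x}
        (lt_min hδ hε)
      have h1 := hρ.2.trans_le (min_le_left _ _)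
      have h2 := hρ.2.trans_le (min_le_right _ _)
      rw [Metric.thickening_singleton, frontier_ball x hρ.1.ne'] at h0
      exact ⟨ρ, ⟨(Metric.closedBall_subset_ball h2).trans hεG, h0⟩, hρ.1, h1⟩)
    (fun _ => 1) (fun _ _ => one_pos)
  have : Countable t := ht.to_subtype
  have hdisj' : Pairwise (Function.onFun Disjoint fun x : t => Metric.ball (x : ℂ) (r x)) :=
    fun x y hxy => (hdisj x.2 y.2 fun e => hxy (Subtype.ext e)).mono
      Metric.ball_subset_closedBall Metric.ball_subset_closedBall
  calc (μ : Measure ℂ) G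
      ≤ (μ : Measure ℂ) (⋃ x : t, Metric.closedBall (x : ℂ) (r x)) := by
        refine measure_mono_ae ?_
        rw [ae_le_set]
        rwa [Set.iUnion_subtype]
    _ ≤ ∑' x : t, (μ : Measure ℂ) (Metric.closedBall (x : ℂ) (r x)) := measure_iUnion_le _
    _ ≤ ∑' x : t, liminf (fun n => (μs n : Measure ℂ) (Metric.ball (x : ℂ) (r x))) atTop :=
        ENNReal.tsum_le_tsum fun x => hball x (htr x x.2).2.1 (htr x x.2).1.2
    _ = ∫⁻ x : t, liminf (fun n => (μs n : Measure ℂ) (Metric.ball (x : ℂ) (r x))) atTop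
          ∂Measure.count := (lintegral_count _).symm
    _ ≤ liminf (fun n => ∫⁻ x : t, (μs n : Measure ℂ) (Metric.ball (x : ℂ) (r x))
          ∂Measure.count) atTop := lintegral_liminf_le fun n => measurable_of_countable _
    _ = liminf (fun n => (μs n : Measure ℂ) (⋃ x : t, Metric.ball (x : ℂ) (r x))) atTop := by
        congr 1
        funext n
        rw [lintegral_count, measure_iUnion hdisj' fun x => measurableSet_ball]
    _ ≤ _ := by
        refine liminf_le_liminf (Eventually.of_forall fun n => measure_mono ?_)
        exact Set.iUnion_subset fun x =>
          Metric.ball_subset_closedBall.trans (htr x x.2).1.1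

theorem toMeasure_empiricalMeasure {n : ℕ} (z : Fin n → ℂ) :
    (empiricalMeasure z : Measure ℂ) = (n : ℝ≥0)⁻¹ • ∑ k, Measure.dirac (z k) := by
  rw [empiricalMeasure, FiniteMeasure.toMeasure_smul, FiniteMeasure.toMeasure_sum]
  rfl

theorem isProbabilityMeasure_empiricalMeasure {n : ℕ} (hn : n ≠ 0) (z : Fin n → ℂ) :
    IsProbabilityMeasure (empiricalMeasure z : Measure ℂ) where
  measure_univ := by
    rw [toMeasure_empiricalMeasure, Measure.smul_apply, ENNReal.smul_def, smul_eq_mul]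
    simp only [Measure.finsetSum_apply, measure_univ, Finset.sum_const, Finset.card_univ,
      Fintype.card_fin, nsmul_eq_mul, mul_one]
    rw [ENNReal.coe_inv (by exact_mod_cast hn), ENNReal.coe_natCast]
    exact ENNReal.inv_mul_cancel (by exact_mod_cast hn) (ENNReal.natCast_ne_top n)

theorem integral_empiricalMeasure {n : ℕ} (z : Fin n → ℂ) (f : ℂ → ℝ) :
    ∫ w, f w ∂(empiricalMeasure z : Measure ℂ) = (n : ℝ)⁻¹ * ∑ k, f (z k) := by
  rw [toMeasure_empiricalMeasure, integral_smul_nnreal_measure, integral_finsetSum_measure]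
  · simp [NNReal.smul_def]
  · intro k _
    exact integrable_dirac (by finiteness)

/-- Two sequences of point configurations whose truncated logarithmic potentials are asymptotically
equal have the same limiting empirical measure. -/
theorem tendsto_empiricalMeasure_of_tendsto_sum_log_max {x y : (n : ℕ) → Fin n → ℂ}
    {μ : FiniteMeasure ℂ} {D : Set ℂ} (hD : Dense D)
    (hx : Tendsto (fun n => empiricalMeasure (x n)) atTop (𝓝 μ))
    (h : ∀ c ∈ D, ∀ r : ℚ, 0 < r → Tendsto (fun n : ℕ => (n : ℝ)⁻¹ *
      (∑ k, Real.log (max r ‖y n k - c‖) - ∑ k, Real.log (max r ‖x n k - c‖))) atTop (𝓝 0)) :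
    Tendsto (fun n => empiricalMeasure (y n)) atTop (𝓝 μ) := by
  -- Total mass passes to weak limits, so the criterion for probability measures applies.
  have hμ : IsProbabilityMeasure (μ : Measure ℂ) := by
    have h1 := hx.mass
    have h2 : Tendsto (fun n => (empiricalMeasure (x n)).mass) atTop (𝓝 1) := by
      refine tendsto_const_nhds.congr' ?_
      filter_upwards [eventually_ne_atTop 0] with n hn
      have := (isProbabilityMeasure_empiricalMeasure hn (x n)).measure_univ
      rw [← FiniteMeasure.ennreal_mass] at this
      exact_mod_cast this.symm
    have h3 := tendsto_nhds_unique h1 h2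
    exact ⟨by rw [← FiniteMeasure.ennreal_mass, h3, ENNReal.coe_one]⟩
  let μ' : ProbabilityMeasure ℂ := ⟨μ, hμ⟩
  -- The index is shifted because the empirical measure of no points is zero, not a probability
  -- measure.
  let ν : ℕ → ProbabilityMeasure ℂ := fun n =>
    ⟨empiricalMeasure (y (n + 1)), isProbabilityMeasure_empiricalMeasure n.succ_ne_zero _⟩
  rw [← tendsto_add_atTop_iff_nat 1]
  have key : Tendsto ν atTop (𝓝 μ') := by
    refine tendsto_of_forall_tendsto_integral_logBump hD fun c hc r R hr hrR => ?_
    have hr' : (0 : ℝ) < r := by exact_mod_cast hr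
    have hrR' : (r : ℝ) < R := by exact_mod_cast hrR
    have hR' : (0 : ℝ) < R := hr'.trans hrR'
    have hcont := continuous_logBump c hr' hR'
    let f : BoundedContinuousFunction ℂ ℝ := BoundedContinuousFunction.ofNormedAddCommGroup
      (logBump c r R) hcont (Real.log (R / r)) fun w => by
        rw [Real.norm_of_nonneg (logBump_nonneg c w hr' hrR'.le)]
        exact logBump_le c w hr' hrR'.le
    have h1 : Tendsto (fun n => ∫ w, logBump c r R w ∂(empiricalMeasure (x n) : Measure ℂ)) atTop
        (𝓝 (∫ w, logBump c r R w ∂(μ : Measure ℂ))) :=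
      FiniteMeasure.tendsto_iff_forall_integral_tendsto.1 hx f
    have h2 := h1.add ((h c hc R (hr.trans hrR)).sub (h c hc r hr))
    have h3 : Tendsto (fun n => ∫ w, logBump c r R w ∂(empiricalMeasure (y n) : Measure ℂ)) atTop
        (𝓝 (∫ w, logBump c r R w ∂(μ : Measure ℂ))) := by
      rw [sub_zero, add_zero] at h2
      refine h2.congr fun n => ?_
      rw [integral_empiricalMeasure, integral_empiricalMeasure]
      simp only [logBump, Finset.sum_sub_distrib]
      ring
    exact (tendsto_add_atTop_iff_nat 1).2 h3
  exact (ProbabilityMeasure.tendsto_nhds_iff_toFiniteMeasure_tendsto_nhds _).1 key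

/-! ### Successive conditioning along the iteration -/

theorem measurable_stepMoment {α : Type*} [MeasurableSpace α] {n : ℕ} (e : ℝ)
    {w : Fin n → α → ℝ} {z : Fin n → α → ℂ} {u : α → ℂ} (hw : ∀ k, Measurable (w k))
    (hz : ∀ k, Measurable (z k)) (hu : Measurable u) :
    Measurable fun a => stepMoment e (fun k => w k a) (fun k => z k a) (u a) := by
  unfold stepMoment
  fun_prop

theorem measurable_sum_erase_div {α : Type*} [MeasurableSpace α] {n : ℕ}
    {w : Fin n → α → ℝ} {z : Fin n → α → ℂ} (u : ℂ) (k : Fin n)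
    (hw : ∀ l, l ≠ k → Measurable (w l)) (hz : ∀ l, Measurable (z l)) :
    Measurable fun a => (∑ l ∈ Finset.univ.erase k, (w l a : ℂ) * ((u + z l a) / (u - z l a))) /
      ((u + z k a) / (u - z k a)) := by
  refine Measurable.div (Finset.measurable_sum _ fun l hl => ?_) (by fun_prop)
  have := hw l (Finset.ne_of_mem_erase hl)
  fun_prop

theorem measurable_prod_stepMoment {α : Type*} [MeasurableSpace α] {n M : ℕ} (e : ℝ)
    {w : Fin M → Fin n → α → ℝ} {z : Fin M → Fin n → α → ℂ} {u : α → ℂ} (s : Finset (Fin M))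
    (hw : ∀ j ∈ s, ∀ k, Measurable (w j k)) (hz : ∀ j ∈ s, ∀ k, Measurable (z j k))
    (hu : Measurable u) :
    Measurable fun a => ∏ j ∈ s, stepMoment e (fun k => w j k a) (fun k => z j k a) (u a) :=
  Finset.measurable_prod _ fun j hj => measurable_stepMoment e (hw j hj) (hz j hj) hu

namespace IsCircularIteration

variable {Ω : Type*} {n M : ℕ} {Z : Fin (M + 1) → Fin n → Ω → ℂ} {γ : Fin M → Fin n → Ω → ℝ}

/-- The initial points together with all the weights but one. -/
def otherData (Z : Fin (M + 1) → Fin n → Ω → ℂ) (γ : Fin M → Fin n → Ω → ℝ) (p : Fin M × Fin n)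
    (ω : Ω) : (Fin n → ℂ) × (↥(Finset.univ.erase p) → ℝ) :=
  (fun k => Z 0 k ω, fun q => γ q.1.1 q.1.2 ω)

theorem measurable_comap_otherData_weight {p q : Fin M × Fin n} (hq : q ≠ p) :
    Measurable[MeasurableSpace.comap (otherData Z γ p) inferInstance] (γ q.1 q.2) := by
  have : γ q.1 q.2 = (fun v : (Fin n → ℂ) × (↥(Finset.univ.erase p) → ℝ) =>
      v.2 ⟨q, Finset.mem_erase.2 ⟨hq, Finset.mem_univ q⟩⟩) ∘ otherData Z γ p := rfl
  rw [this]
  exact Measurable.comp (by fun_prop) (comap_measurable _)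

/-- The history at time j only uses weights with index below j, so the omitted weight, of index p.1
≥ j, is not among them. -/
theorem stepHistory_le_comap_otherData (p : Fin M × Fin n) {j : ℕ} (hj : j ≤ p.1) :
    stepHistory (Z 0) γ j ≤ MeasurableSpace.comap (otherData Z γ p) inferInstance := by
  refine sup_le (iSup_le fun k => ?_) (iSup_le fun i => iSup_le fun hi => iSup_le fun k => ?_)
  · have : Z 0 k = (fun v : (Fin n → ℂ) × (↥(Finset.univ.erase p) → ℝ) => v.1 k) ∘
        otherData Z γ p := rfl
    rw [this]
    exact (Measurable.comp (by fun_prop) (comap_measurable _)).comap_le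
  · refine Measurable.comap_le (measurable_comap_otherData_weight (q := (i, k)) fun e => ?_)
    rw [← e] at hj
    exact absurd hi (not_lt.2 hj)

variable [mΩ : MeasurableSpace Ω] {P : Measure Ω} {β : ℝ}

theorem stepHistory_le (h : IsCircularIteration P β n M Z γ) (j : ℕ) :
    stepHistory (Z 0) γ j ≤ mΩ :=
  sup_le (iSup_le fun k => (h.measurable_initial k).comap_le)
    (iSup_le fun i => iSup_le fun _ => iSup_le fun k => (h.measurable_weight i k).comap_le)

theorem measurable_points (h : IsCircularIteration P β n M Z γ) (j : Fin (M + 1)) (k : Fin n) :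
    Measurable (Z j k) :=
  (h.adapted j k).mono (h.stepHistory_le j) le_rfl

theorem measurable_otherData (h : IsCircularIteration P β n M Z γ) (p : Fin M × Fin n) :
    Measurable (otherData Z γ p) :=
  (measurable_pi_lambda _ h.measurable_initial).prodMk
    (measurable_pi_lambda _ fun q => h.measurable_weight q.1.1 q.1.2)

theorem indepFun_otherData [IsProbabilityMeasure P] (h : IsCircularIteration P β n M Z γ) (p : Fin M × Fin n) :
    IndepFun (otherData Z γ p) (γ p.1 p.2) P := by
  have h1 := h.indep_weights.indepFun_finset (Finset.univ.erase p) {p} (by simp)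
    fun q => h.measurable_weight q.1 q.2
  have h2 : IndepFun (fun ω (q : ↥(Finset.univ.erase p)) => γ q.1.1 q.1.2 ω) (γ p.1 p.2) P :=
    h1.comp (φ := id) (ψ := fun v : ↥({p} : Finset (Fin M × Fin n)) → ℝ =>
      v ⟨p, Finset.mem_singleton_self p⟩) measurable_id (measurable_pi_apply _)
  have h3 : IndepFun (fun ω k => Z 0 k ω)
      (fun ω => ((fun q : ↥(Finset.univ.erase p) => γ q.1.1 q.1.2 ω), γ p.1 p.2 ω)) P :=
    h.indep_initial.comp (φ := id) (ψ := fun v : Fin M × Fin n → ℝ =>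
      ((fun q : ↥(Finset.univ.erase p) => v q.1), v p)) measurable_id (by fun_prop)
  exact h3.prodMk_of_indepFun (measurable_pi_lambda _ h.measurable_initial)
    (measurable_pi_lambda _ fun q => h.measurable_weight q.1.1 q.1.2)
    (h.measurable_weight p.1 p.2) h2

/-- Induction on the number of steps. In the k-th summand of the last step, everything except the
weight of index k is a function of `otherData`; integrating that weight out costs a factor K, and
there are n summands. -/
theorem lintegral_prod_stepMoment_le [IsProbabilityMeasure P]
    (h : IsCircularIteration P β n M Z γ) {e : ℝ} {K : ℝ≥0∞}
    (hK : ∀ b : ℂ, ∫⁻ x, ‖(x : ℂ) + b‖ₑ ^ (-e) ∂(gammaMeasure (β / 2) 1) ≤ K) (u : ℂ) :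
    ∫⁻ ω, ∏ j, stepMoment e (fun k => γ j k ω) (fun k => Z j.castSucc k ω) u ∂P ≤ (K * n) ^ M := by
  suffices H : ∀ m ≤ M, ∫⁻ ω, ∏ j ∈ Finset.univ.filter (fun j : Fin M => j.val < m),
      stepMoment e (fun k => γ j k ω) (fun k => Z j.castSucc k ω) u ∂P ≤ (K * n) ^ m by
    have := H M le_rfl
    rwa [Finset.filter_true_of_mem fun j _ => j.2] at this
  intro m
  induction m with
  | zero => intro _; simp
  | succ m ih =>
    intro hm
    set j : Fin M := ⟨m, hm⟩ with hj
    set s := Finset.univ.filter (fun j : Fin M => j.val < m) with hs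
    have hins : Finset.univ.filter (fun j : Fin M => j.val < m + 1) = insert j s := by
      ext i
      simp only [hs, hj, Finset.mem_filter, Finset.mem_univ, true_and, Finset.mem_insert,
        Fin.ext_iff]
      omega
    have hjs : j ∉ s := by simp [hs, hj]
    set A : Ω → ℝ≥0∞ := fun ω =>
      ∏ i ∈ s, stepMoment e (fun k => γ i k ω) (fun k => Z i.castSucc k ω) u with hA
    set b : Fin n → Ω → ℂ := fun k ω =>
      (∑ l ∈ Finset.univ.erase k, (γ j l ω : ℂ) *
        ((u + Z j.castSucc l ω) / (u - Z j.castSucc l ω))) /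
        ((u + Z j.castSucc k ω) / (u - Z j.castSucc k ω)) with hb
    have hZm : ∀ (k : Fin n) (i : Fin M), i ≤ j → ∀ l,
        Measurable[MeasurableSpace.comap (otherData Z γ (j, k)) inferInstance]
          (Z i.castSucc l) := fun k i hi l =>
      (h.adapted i.castSucc l).mono (stepHistory_le_comap_otherData (j, k) hi) le_rfl
    have hlt : ∀ i ∈ s, i < j := fun i hi => (Finset.mem_filter.1 hi).2
    have hγm : ∀ (k : Fin n), ∀ i ∈ s, ∀ l,
        Measurable[MeasurableSpace.comap (otherData Z γ (j, k)) inferInstance] (γ i l) :=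
      fun k i hi l => measurable_comap_otherData_weight (q := (i, l)) fun e =>
        (hlt i hi).ne (congrArg Prod.fst e)
    have hAm : ∀ k, Measurable[MeasurableSpace.comap (otherData Z γ (j, k)) inferInstance] A :=
      fun k => @measurable_prod_stepMoment Ω (MeasurableSpace.comap (otherData Z γ (j, k))
        inferInstance) n M e γ (fun i => Z i.castSucc) (fun _ => u) s (hγm k)
        (fun i hi l => hZm k i (hlt i hi).le l) (@measurable_const _ _ _ _ _)
    have hbm : ∀ k, Measurable[MeasurableSpace.comap (otherData Z γ (j, k)) inferInstance] (b k) :=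
      fun k => @measurable_sum_erase_div Ω (MeasurableSpace.comap (otherData Z γ (j, k))
        inferInstance) n (γ j) (Z j.castSucc) u k
        (fun l hl => measurable_comap_otherData_weight (q := (j, l)) fun e =>
          hl (congrArg Prod.snd e)) (fun l => hZm k j le_rfl l)
    have hle : ∀ k, (MeasurableSpace.comap (otherData Z γ (j, k)) inferInstance) ≤ mΩ := fun k =>
      (h.measurable_otherData (j, k)).comap_le
    have hterm : ∀ k, ∫⁻ ω, A ω * ‖(γ j k ω : ℂ) + b k ω‖ₑ ^ (-e) ∂P ≤ K * ∫⁻ ω, A ω ∂P :=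
      fun k => lintegral_mul_enorm_add_rpow_le (h.measurable_otherData (j, k))
        (h.measurable_weight j k) (h.indepFun_otherData (j, k)) (hAm k) (hbm k)
        (by rw [(h.law_weight j k).map_eq]; exact hK)
    rw [hins]
    simp only [Finset.prod_insert hjs]
    calc ∫⁻ ω, stepMoment e (fun k => γ j k ω) (fun k => Z j.castSucc k ω) u * A ω ∂P
        = ∫⁻ ω, ∑ k, A ω * ‖(γ j k ω : ℂ) + b k ω‖ₑ ^ (-e) ∂P := by
          refine lintegral_congr fun ω => ?_
          rw [mul_comm, stepMoment, Finset.mul_sum]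
      _ = ∑ k, ∫⁻ ω, A ω * ‖(γ j k ω : ℂ) + b k ω‖ₑ ^ (-e) ∂P := by
          refine lintegral_finsetSum _ fun k _ => ?_
          have h1 := (hAm k).mono (hle k) le_rfl
          have h2 := (hbm k).mono (hle k) le_rfl
          have h3 := h.measurable_weight j k
          fun_prop
      _ ≤ ∑ _k : Fin n, K * ∫⁻ ω, A ω ∂P := Finset.sum_le_sum fun k _ => hterm k
      _ = (K * n) * ∫⁻ ω, A ω ∂P := by simp; ring
      _ ≤ (K * n) * (K * n) ^ m := by gcongr; exact ih (by omega)
      _ = _ := by rw [pow_succ, mul_comm]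

theorem lintegral_lintegral_prod_stepMoment_le [IsProbabilityMeasure P]
    (h : IsCircularIteration P β n M Z γ) {e : ℝ}
    {K : ℝ≥0∞}
    (hK : ∀ b : ℂ, ∫⁻ x, ‖(x : ℂ) + b‖ₑ ^ (-e) ∂(gammaMeasure (β / 2) 1) ≤ K) (ν : Measure ℂ)
    [IsProbabilityMeasure ν] :
    ∫⁻ ω, ∫⁻ u, ∏ j, stepMoment e (fun k => γ j k ω) (fun k => Z j.castSucc k ω) u ∂ν ∂P ≤
      (K * n) ^ M := by
  rw [lintegral_lintegral_swap]
  · refine (lintegral_mono fun u => h.lintegral_prod_stepMoment_le hK u).trans ?_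
    simp
  · refine (measurable_prod_stepMoment e (α := Ω × ℂ) (w := fun j k q => γ j k q.1)
      (z := fun j k q => Z j.castSucc k q.1) (u := fun q => q.2) Finset.univ ?_ ?_
      measurable_snd).aemeasurable
    · exact fun j _ k => (h.measurable_weight j k).comp measurable_fst
    · exact fun j _ k => (h.measurable_points j.castSucc k).comp measurable_fst

theorem measurable_lintegral_prod_stepMoment (h : IsCircularIteration P β n M Z γ) (e : ℝ)
    (ν : Measure ℂ) [IsProbabilityMeasure ν] :
    Measurable fun ω =>
      ∫⁻ u, ∏ j, stepMoment e (fun k => γ j k ω) (fun k => Z j.castSucc k ω) u ∂ν := by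
  refine Measurable.lintegral_prod_right'
    (f := fun q : Ω × ℂ => ∏ j, stepMoment e (fun k => γ j k q.1) (fun k => Z j.castSucc k q.1) q.2)
    ?_
  refine measurable_prod_stepMoment e (α := Ω × ℂ) (w := fun j k q => γ j k q.1)
      (z := fun j k q => Z j.castSucc k q.1) (u := fun q => q.2) Finset.univ ?_ ?_ measurable_snd
  · exact fun j _ k => (h.measurable_weight j k).comp measurable_fst
  · exact fun j _ k => (h.measurable_points j.castSucc k).comp measurable_fst

theorem ae_weight_pos (h : IsCircularIteration P β n M Z γ) :
    ∀ᵐ ω ∂P, ∀ j k, 0 < γ j k ω := by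
  refine ae_all_iff.2 fun j => ae_all_iff.2 fun k => ?_
  have := ae_pos_gammaMeasure (β / 2)
  rw [← (h.law_weight j k).map_eq] at this
  exact ae_of_ae_map (h.measurable_weight j k).aemeasurable this

theorem lintegral_sum_weight_le (h : IsCircularIteration P β n M Z γ) (j : Fin M) :
    ∫⁻ ω, ∑ k, ‖γ j k ω‖ₑ ∂P ≤ n * ∫⁻ x, ‖x‖ₑ ∂(gammaMeasure (β / 2) 1) := by
  rw [lintegral_finsetSum _ fun k _ => (h.measurable_weight j k).enorm]
  have : ∀ k, ∫⁻ ω, ‖γ j k ω‖ₑ ∂P = ∫⁻ x, ‖x‖ₑ ∂(gammaMeasure (β / 2) 1) := fun k => by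
    rw [← (h.law_weight j k).map_eq, lintegral_map (by fun_prop) (h.measurable_weight j k)]
  simp [this]

end IsCircularIteration

/-! ### Good events and Borel–Cantelli -/

/-- On a good event, the potential averaged on a circle changes by at most a logarithm of the degree
at each step. -/
theorem exists_abs_sum_log_max_sub_le (c : ℂ) {r : ℝ} (hr : 0 < r) (b : ℕ) {C e : ℝ} (hC : 1 ≤ C)
    (he : 0 < e) :
    ∃ a : ℝ, ∀ (n M : ℕ) (w : Fin M → Fin n → ℝ) (z : Fin (M + 1) → Fin n → ℂ), 2 ≤ n → 1 ≤ M →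
      (∀ j k, 0 < w j k) →
      (∀ j : Fin M, Multiset.map (z j.succ) Finset.univ.val =
        (circularDeriv (w j) (z j.castSucc)).roots) →
      (∀ j : Fin M, ∃ k, ‖z j.castSucc k‖ ≤ (n : ℝ) ^ b) →
      (∀ j, ∑ k, w j k ≤ (n : ℝ) ^ 4) →
      ∫⁻ u, ∏ j, stepMoment e (w j) (z j.castSucc) u ∂(circleUniform c r) ≤
        ENNReal.ofReal ((n : ℝ) ^ 2 * (C * n) ^ M) →
      |∑ l, Real.log (max r ‖z (Fin.last M) l - c‖) - ∑ l, Real.log (max r ‖z 0 l - c‖)| ≤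
        a * (M * Real.log n) := by
  obtain ⟨A, hA, hup⟩ := exists_sum_log_max_sub_le_mul c hr
  set a₀ : ℝ := 2 * Real.log (1 + A) + |Real.log r| + |Real.log (r + 1 + ‖c‖)| + Real.log C / e
    with ha₀
  -- Coefficients of log n: 2 from the deterministic upper bound, b from the smallest point, 4 from
  -- the total weight, and 3/e from n²(Cn)^M ≤ (Cn³)^M, which uses M ≥ 1. The constants a₀ are
  -- absorbed through log 2 ≤ log n.
  set a₁ : ℝ := 2 + b + 4 + 3 / e with ha₁
  refine ⟨a₀ / Real.log 2 + a₁, fun n M w z hn hM hw hz hk hG hV => ?_⟩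
  have hn0 : (0 : ℝ) < n := by positivity
  have hn1 : (1 : ℝ) ≤ n := by exact_mod_cast (by omega : 1 ≤ n)
  have hM1 : (1 : ℝ) ≤ M := by exact_mod_cast hM
  have hM0 : (0 : ℝ) ≤ M := by positivity
  have hl2 : 0 < Real.log 2 := Real.log_pos one_lt_two
  have hln : Real.log 2 ≤ Real.log n := Real.log_le_log two_pos (by exact_mod_cast hn)
  have hln0 : 0 ≤ Real.log n := hl2.le.trans hln
  have hlA : 0 ≤ Real.log (1 + A) := Real.log_nonneg (by linarith)
  have hlC : 0 ≤ Real.log C / e := div_nonneg (Real.log_nonneg hC) he.le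
  have ha₀0 : 0 ≤ a₀ := by positivity
  have hred : a₀ + a₁ * Real.log n ≤ (a₀ / Real.log 2 + a₁) * Real.log n := by
    have : a₀ ≤ a₀ / Real.log 2 * Real.log n := by
      rw [div_mul_eq_mul_div, le_div_iff₀ hl2]
      exact mul_le_mul_of_nonneg_left hln ha₀0
    linarith
  suffices H : |∑ l, Real.log (max r ‖z (Fin.last M) l - c‖) -
      ∑ l, Real.log (max r ‖z 0 l - c‖)| ≤ M * (a₀ + a₁ * Real.log n) by
    refine H.trans ((mul_le_mul_of_nonneg_left hred hM0).trans_eq (by ring))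
  have h3e : 0 ≤ 3 / e := by positivity
  have habs := abs_nonneg (Real.log r)
  have habs' := abs_nonneg (Real.log (r + 1 + ‖c‖))
  have hb0 : (0 : ℝ) ≤ b := b.cast_nonneg
  rw [abs_le]
  constructor
  · choose k hk using hk
    have hKpos : 0 < (n : ℝ) ^ 2 * (C * n) ^ M := by positivity
    have hlow := le_sum_log_max_sub c hr hw hz k hk hG he hKpos hV
    have h1 : Real.log ((n : ℝ) ^ 2 * (C * n) ^ M) ≤ M * (Real.log C + 3 * Real.log n) := by
      rw [Real.log_mul (by positivity) (by positivity), Real.log_pow, Real.log_pow,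
        Real.log_mul (by positivity) hn0.ne']
      push_cast
      nlinarith
    have h2 : Real.log (max r ((n : ℝ) ^ b + ‖c‖)) ≤ Real.log (r + 1 + ‖c‖) + b * Real.log n := by
      have hpow : (1 : ℝ) ≤ (n : ℝ) ^ b := one_le_pow₀ hn1
      rw [← Real.log_pow, ← Real.log_mul (by positivity) (by positivity)]
      refine Real.log_le_log (by positivity) (max_le ?_ ?_)
      · nlinarith [norm_nonneg c]
      · nlinarith [norm_nonneg c]
    have h3 : Real.log ((n : ℝ) ^ 2 * (C * n) ^ M) / e ≤
        M * (Real.log C / e + 3 / e * Real.log n) := by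
      rw [div_le_iff₀ he]
      refine h1.trans_eq ?_
      field_simp
    rw [Real.log_pow] at hlow
    refine le_trans ?_ hlow
    have h4 : -(a₀ + a₁ * Real.log n) + (Real.log C / e + 3 / e * Real.log n) ≤
        Real.log r - Real.log (max r ((n : ℝ) ^ b + ‖c‖)) - (4 : ℕ) * Real.log n := by
      have h5 := neg_abs_le (Real.log r)
      have h6 := le_abs_self (Real.log (r + 1 + ‖c‖))
      rw [ha₀, ha₁]
      push_cast
      linarith
    have h7 := mul_le_mul_of_nonneg_left h4 hM0
    linarith
  · refine (hup n M w z hw (by omega) hz).trans (mul_le_mul_of_nonneg_left ?_ hM0)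
    have h1 : Real.log (1 + A * n) ≤ Real.log (1 + A) + Real.log n := by
      rw [← Real.log_mul (by positivity) hn0.ne']
      exact Real.log_le_log (by positivity) (by nlinarith)
    have h2 : 0 ≤ (b + 4 + 3 / e) * Real.log n := by positivity
    rw [ha₀, ha₁]
    linarith

namespace IsCircularIteration

variable {Ω : Type*} [mΩ : MeasurableSpace Ω] {P : Measure Ω} {β : ℝ} {n M : ℕ}
  {Z : Fin (M + 1) → Fin n → Ω → ℂ} {γ : Fin M → Fin n → Ω → ℝ}

/-- The event on which all the quantities controlling the iteration have a polynomial size. -/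
def goodEvent (Z : Fin (M + 1) → Fin n → Ω → ℂ) (γ : Fin M → Fin n → Ω → ℝ) (b : ℕ) (C e : ℝ)
    (ν : Measure ℂ) : Set Ω :=
  {ω | (∀ j : Fin M, ⨅ k, ‖Z j.castSucc k ω‖ₑ < (n : ℝ≥0∞) ^ b) ∧
    (∀ j : Fin M, ∑ k, ‖γ j k ω‖ₑ < (n : ℝ≥0∞) ^ 4) ∧
    ∫⁻ u, ∏ j, stepMoment e (fun k => γ j k ω) (fun k => Z j.castSucc k ω) u ∂ν <
      ENNReal.ofReal ((n : ℝ) ^ 2 * (C * n) ^ M)}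

/-- Markov's inequality for each of the three conditions. The thresholds exceed the means by n³ in
the first two, since the union over at most n steps loses a factor n; the third involves all steps
at once and needs only n². -/
theorem measure_compl_goodEvent_le [IsProbabilityMeasure P]
    (h : IsCircularIteration P β n M Z γ) (hn : 2 ≤ n) (hM : M ≤ n) {b : ℕ} {C e : ℝ} (hC : 1 ≤ C)
    {K : ℝ≥0∞}
    (hK : ∀ j : Fin M, ∫⁻ ω, ⨅ k, ‖Z j.castSucc k ω‖ₑ ∂P ≤ K * (n : ℝ≥0∞) ^ b)
    (hC' : ∀ b : ℂ, ∫⁻ x, ‖(x : ℂ) + b‖ₑ ^ (-e) ∂(gammaMeasure (β / 2) 1) ≤ ENNReal.ofReal C)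
    (ν : Measure ℂ) [IsProbabilityMeasure ν] :
    P (goodEvent Z γ (b + 3) C e ν)ᶜ ≤
      (K + ∫⁻ x, ‖x‖ₑ ∂(gammaMeasure (β / 2) 1) + 1) / (n : ℝ≥0∞) ^ 2 := by
  set G := ∫⁻ x, ‖x‖ₑ ∂(gammaMeasure (β / 2) 1) with hG
  have hn0 : (n : ℝ≥0∞) ≠ 0 := by exact_mod_cast (by omega : n ≠ 0)
  have hnt : (n : ℝ≥0∞) ≠ ∞ := ENNReal.natCast_ne_top n
  have hMn : (M : ℝ≥0∞) ≤ n := by exact_mod_cast hM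
  have hp0 : ∀ d : ℕ, (n : ℝ≥0∞) ^ d ≠ 0 := fun d => pow_ne_zero d hn0
  have hpt : ∀ d : ℕ, (n : ℝ≥0∞) ^ d ≠ ∞ := fun d => ENNReal.pow_ne_top hnt
  have hunion : ∀ (X : Fin M → Ω → ℝ≥0∞) (a x : ℝ≥0∞) (d : ℕ), (∀ j, Measurable (X j)) →
      (∀ j, ∫⁻ ω, X j ω ∂P ≤ x * (n : ℝ≥0∞) ^ d) →
      P (⋃ j, {ω | (n : ℝ≥0∞) ^ (d + 3) ≤ X j ω}) ≤ x / (n : ℝ≥0∞) ^ 2 := by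
    intro X a x d hX hXe
    refine (measure_iUnion_le _).trans ?_
    rw [tsum_fintype]
    have h1 : ∀ j, P {ω | (n : ℝ≥0∞) ^ (d + 3) ≤ X j ω} ≤ x / (n : ℝ≥0∞) ^ 3 := fun j => by
      refine (meas_ge_le_lintegral_div (hX j).aemeasurable (hp0 _) (hpt _)).trans ?_
      rw [pow_add, mul_comm ((n : ℝ≥0∞) ^ d)]
      refine (ENNReal.div_le_div_right (hXe j) _).trans_eq ?_
      exact ENNReal.mul_div_mul_right _ _ (hp0 d) (hpt d)
    refine (Finset.sum_le_sum fun j _ => h1 j).trans ?_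
    simp only [Finset.sum_const, Finset.card_univ, Fintype.card_fin, nsmul_eq_mul]
    refine (mul_le_mul_left hMn _).trans_eq ?_
    rw [pow_succ, ← mul_div_assoc, mul_comm]
    exact ENNReal.mul_div_mul_right _ _ hn0 hnt
  have hsub : (goodEvent Z γ (b + 3) C e ν)ᶜ ⊆
      ((⋃ j : Fin M, {ω | (n : ℝ≥0∞) ^ (b + 3) ≤ ⨅ k, ‖Z j.castSucc k ω‖ₑ}) ∪
        (⋃ j : Fin M, {ω | (n : ℝ≥0∞) ^ (1 + 3) ≤ ∑ k, ‖γ j k ω‖ₑ})) ∪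
      {ω | ENNReal.ofReal ((n : ℝ) ^ 2 * (C * n) ^ M) ≤
        ∫⁻ u, ∏ j, stepMoment e (fun k => γ j k ω) (fun k => Z j.castSucc k ω) u ∂ν} := by
    intro ω hω
    by_contra hcon
    simp only [Set.mem_union, Set.mem_iUnion, Set.mem_ofPred_eq, not_or, not_exists, not_le] at hcon
    exact hω ⟨hcon.1.1, hcon.1.2, hcon.2⟩
  refine (measure_mono hsub).trans ((measure_union_le _ _).trans ?_)
  rw [ENNReal.add_div, ENNReal.add_div]
  refine add_le_add ((measure_union_le _ _).trans (add_le_add ?_ ?_)) ?_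
  · exact hunion _ 0 K b (fun j => Measurable.iInf fun k => (h.measurable_points _ k).enorm) hK
  · refine hunion _ 0 G 1 (fun j => Finset.measurable_sum _ fun k _ =>
      (h.measurable_weight j k).enorm) fun j => (h.lintegral_sum_weight_le j).trans_eq ?_
    rw [pow_one, mul_comm]
  · have hCn : ENNReal.ofReal ((n : ℝ) ^ 2 * (C * n) ^ M) =
        (n : ℝ≥0∞) ^ 2 * (ENNReal.ofReal C * n) ^ M := by
      have hC0 : 0 ≤ C := zero_le_one.trans hC
      rw [ENNReal.ofReal_mul (by positivity), ENNReal.ofReal_pow (by positivity),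
        ENNReal.ofReal_pow (by positivity), ENNReal.ofReal_mul hC0, ENNReal.ofReal_natCast]
    have hX0 : (ENNReal.ofReal C * n) ^ M ≠ 0 := pow_ne_zero _
      (mul_ne_zero (by simpa using zero_lt_one.trans_le hC) hn0)
    have hXt : (ENNReal.ofReal C * n) ^ M ≠ ∞ :=
      ENNReal.pow_ne_top (ENNReal.mul_ne_top ENNReal.ofReal_ne_top hnt)
    rw [hCn]
    refine (meas_ge_le_lintegral_div (h.measurable_lintegral_prod_stepMoment e ν).aemeasurable
      (mul_ne_zero (hp0 2) hX0) (ENNReal.mul_ne_top (hpt 2) hXt)).trans ?_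
    refine (ENNReal.div_le_div_right (h.lintegral_lintegral_prod_stepMoment_le hC' ν) _).trans_eq ?_
    have := ENNReal.mul_div_mul_right 1 ((n : ℝ≥0∞) ^ 2) hX0 hXt
    rwa [one_mul] at this

end IsCircularIteration

theorem tsum_div_natCast_sq_ne_top {K : ℝ≥0∞} (hK : K ≠ ∞) {s : ℕ → ℝ≥0∞}
    (hs : ∀ n, s n ≤ K / (n : ℝ≥0∞) ^ 2) (hs0 : s 0 ≠ ∞) : ∑' n, s n ≠ ∞ := by
  -- The term n = 0 is split off, since there the bound divides by zero.
  rw [tsum_eq_zero_add' ENNReal.summable]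
  refine ENNReal.add_ne_top.2 ⟨hs0, ?_⟩
  have h1 : ∑' n : ℕ, (((n + 1 : ℕ) : ℝ≥0∞) ^ 2)⁻¹ ≠ ∞ := by
    have hsum : Summable fun n : ℕ => ((((n + 1 : ℕ) : ℝ≥0)) ^ 2)⁻¹ :=
      NNReal.summable_nat_add (fun n : ℕ => ((n : ℝ≥0) ^ 2)⁻¹)
        (by exact_mod_cast NNReal.summable_rpow_inv (p := 2) |>.2 one_lt_two) 1
    have := ENNReal.tsum_coe_ne_top_iff_summable.2 hsum
    convert this using 3 with n
    rw [ENNReal.coe_inv (by positivity)]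
    push_cast
    rfl
  refine ne_top_of_le_ne_top (ENNReal.mul_ne_top hK h1) ?_
  rw [← ENNReal.tsum_mul_left]
  exact ENNReal.tsum_le_tsum fun n => hs (n + 1)

theorem eventually_le_of_tendsto_div_div_log {m : ℕ → ℕ}
    (hmn : Tendsto (fun n : ℕ => (m n : ℝ) / ((n : ℝ) / Real.log n)) atTop (𝓝 0)) :
    ∀ᶠ n in atTop, m n ≤ n := by
  have h1 : ∀ᶠ n : ℕ in atTop, (m n : ℝ) / ((n : ℝ) / Real.log n) < Real.log 2 :=
    hmn.eventually_lt_const (Real.log_pos one_lt_two)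
  filter_upwards [h1, eventually_ge_atTop 2] with n hn hn2
  have hn0 : (0 : ℝ) < n := by positivity
  have hln : Real.log 2 ≤ Real.log n := Real.log_le_log two_pos (by exact_mod_cast hn2)
  have hl2 : 0 < Real.log 2 := Real.log_pos one_lt_two
  have hl : 0 < Real.log n := hl2.trans_le hln
  rw [div_lt_iff₀ (by positivity)] at hn
  have h2 : Real.log 2 * (n / Real.log n) ≤ n := by
    rw [mul_div_assoc', div_le_iff₀ hl, mul_comm]
    gcongr
  exact_mod_cast (hn.le.trans h2)

theorem ae_tendsto_sum_log_max_sub {Ω : Type*} [MeasurableSpace Ω] (P : Measure Ω)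
    [IsProbabilityMeasure P] {β : ℝ} (hβ : 0 < β) {m : ℕ → ℕ} (hm : ∀ n, 2 ≤ n → 1 ≤ m n)
    {Z : (n : ℕ) → Fin (m n + 1) → Fin n → Ω → ℂ} {γ : (n : ℕ) → Fin (m n) → Fin n → Ω → ℝ}
    (hZ : ∀ n, 2 ≤ n → IsCircularIteration P β n (m n) (Z n) (γ n))
    (hmn : Tendsto (fun n : ℕ => (m n : ℝ) / ((n : ℝ) / Real.log n)) atTop (𝓝 0))
    {b : ℕ} {K : ℝ≥0∞} (hKt : K ≠ ∞)
    (hK : ∀ n, 2 ≤ n → ∀ j : Fin (m n),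
      ∫⁻ ω, ⨅ k, ‖Z n j.castSucc k ω‖ₑ ∂P ≤ K * (n : ℝ≥0∞) ^ b)
    (c : ℂ) {r : ℝ} (hr : 0 < r) :
    ∀ᵐ ω ∂P, Tendsto (fun n : ℕ => (n : ℝ)⁻¹ *
      (∑ k, Real.log (max r ‖Z n (Fin.last (m n)) k ω - c‖) -
        ∑ k, Real.log (max r ‖Z n 0 k ω - c‖))) atTop (𝓝 0) := by
  obtain ⟨C₀, hC₀t, hC₀⟩ := exists_lintegral_gammaMeasure_enorm_add_rpow_le (half_pos hβ)
  set e : ℝ := β / 2 / (2 * (β / 2 + 2)) with he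
  have he0 : 0 < e := by positivity
  set C : ℝ := max 1 C₀.toReal with hC
  have hC1 : 1 ≤ C := le_max_left _ _
  have hC' : ∀ b : ℂ, ∫⁻ x, ‖(x : ℂ) + b‖ₑ ^ (-e) ∂(gammaMeasure (β / 2) 1) ≤
      ENNReal.ofReal C := fun b => (hC₀ b).trans <| by
    rw [← ENNReal.ofReal_toReal hC₀t]
    exact ENNReal.ofReal_le_ofReal (le_max_right _ _)
  obtain ⟨a, ha⟩ := exists_abs_sum_log_max_sub_le c hr (b + 3) hC1 he0
  -- The bad event is made empty when n < 2 or m n > n, where the probability estimate is not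
  -- available; neither case occurs for large n.
  set bad : ℕ → Set Ω := fun n => {ω | 2 ≤ n ∧ m n ≤ n ∧
    ω ∉ IsCircularIteration.goodEvent (Z n) (γ n) (b + 3) C e (circleUniform c r)} with hbad
  have hbadP : ∑' n, P (bad n) ≠ ∞ := by
    refine tsum_div_natCast_sq_ne_top (K := K + ∫⁻ x, ‖x‖ₑ ∂(gammaMeasure (β / 2) 1) + 1) ?_ ?_
      (measure_ne_top _ _)
    · exact ENNReal.add_ne_top.2 ⟨ENNReal.add_ne_top.2
        ⟨hKt, (lintegral_enorm_gammaMeasure_lt_top (half_pos hβ)).ne⟩, ENNReal.one_ne_top⟩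
    · intro n
      by_cases hn : 2 ≤ n ∧ m n ≤ n
      · refine (measure_mono fun ω hω => hω.2.2).trans
          ((hZ n hn.1).measure_compl_goodEvent_le hn.1 hn.2 hC1 (hK n hn.1) hC'
            (circleUniform c r))
      · have : bad n = ∅ := Set.eq_empty_of_forall_notMem fun ω hω => hn ⟨hω.1, hω.2.1⟩
        rw [this, measure_empty]
        exact zero_le
  have hpos : ∀ᵐ ω ∂P, ∀ n, 2 ≤ n → ∀ j k, 0 < γ n j k ω :=
    ae_all_iff.2 fun n => by
      by_cases hn : 2 ≤ n
      · exact (hZ n hn).ae_weight_pos.mono fun ω hω _ => hω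
      · exact ae_of_all _ fun ω h => absurd h hn
  have hzeros : ∀ᵐ ω ∂P, ∀ n, 2 ≤ n → ∀ j : Fin (m n),
      Multiset.map (fun k => Z n j.succ k ω) Finset.univ.val =
        (circularDeriv (fun k => γ n j k ω) (fun k => Z n j.castSucc k ω)).roots :=
    ae_all_iff.2 fun n => by
      by_cases hn : 2 ≤ n
      · exact (hZ n hn).zeros.mono fun ω hω _ => hω
      · exact ae_of_all _ fun ω h => absurd h hn
  filter_upwards [ae_eventually_notMem hbadP, hpos, hzeros] with ω hω hγ hroots
  have hlim : Tendsto (fun n : ℕ => a * ((m n : ℝ) / ((n : ℝ) / Real.log n))) atTop (𝓝 0) := by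
    simpa using hmn.const_mul a
  refine squeeze_zero_norm' ?_ hlim
  filter_upwards [hω, eventually_ge_atTop 2, eventually_le_of_tendsto_div_div_log hmn]
    with n hn hn2 hmn'
  have hgood : ω ∈ IsCircularIteration.goodEvent (Z n) (γ n) (b + 3) C e (circleUniform c r) := by
    by_contra hcon
    exact hn ⟨hn2, hmn', hcon⟩
  obtain ⟨h1, h2, h3⟩ := hgood
  have hn0 : (0 : ℝ) < n := by positivity
  have : Nonempty (Fin n) := ⟨⟨0, by omega⟩⟩
  have hbound := ha n (m n) (fun j k => γ n j k ω) (fun j k => Z n j k ω) hn2 (hm n hn2)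
    (hγ n hn2) (hroots n hn2) (fun j => ?_) (fun j => ?_) h3.le
  · rw [norm_mul, norm_inv, Real.norm_natCast, Real.norm_eq_abs]
    refine (mul_le_mul_of_nonneg_left hbound (by positivity)).trans_eq ?_
    rw [div_div_eq_mul_div]
    ring
  · obtain ⟨k, hk⟩ := iInf_lt_iff.1 (h1 j)
    refine ⟨k, ?_⟩
    rw [← ofReal_norm, ← ENNReal.ofReal_natCast n, ← ENNReal.ofReal_pow hn0.le] at hk
    exact ((ENNReal.ofReal_lt_ofReal_iff (by positivity)).1 hk).le
  · have h4 := h2 j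
    have h5 : ∑ k, ‖γ n j k ω‖ₑ = ENNReal.ofReal (∑ k, γ n j k ω) := by
      rw [ENNReal.ofReal_sum_of_nonneg fun k _ => (hγ n hn2 j k).le]
      exact Finset.sum_congr rfl fun k _ => Real.enorm_of_nonneg (hγ n hn2 j k).le
    rw [h5, ← ENNReal.ofReal_natCast n, ← ENNReal.ofReal_pow hn0.le] at h4
    exact ((ENNReal.ofReal_lt_ofReal_iff (by positivity)).1 h4).le

theorem theorem5 {Ω : Type*} [MeasurableSpace Ω] (P : Measure Ω) [IsProbabilityMeasure P]
    (β : ℝ) (hβ : 0 < β)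
    (m : ℕ → ℕ) (hm : ∀ n, 2 ≤ n → 1 ≤ m n)
    (Z : (n : ℕ) → Fin (m n + 1) → Fin n → Ω → ℂ)
    (γ : (n : ℕ) → Fin (m n) → Fin n → Ω → ℝ)
    (hZ : ∀ n, 2 ≤ n → IsCircularIteration P β n (m n) (Z n) (γ n))
    (μ : FiniteMeasure ℂ)
    (hμ : ∀ᵐ ω ∂P, Tendsto (fun n => empiricalMeasure (fun k => Z n 0 k ω)) atTop (𝓝 μ))
    (hmn : Tendsto (fun n : ℕ => (m n : ℝ) / ((n : ℝ) / Real.log n)) atTop (𝓝 0))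
    (hmin : ∃ B : ℝ, 0 ≤ B ∧
      (⨆ (n : ℕ) (_ : 2 ≤ n), (n : ℝ≥0∞) ^ (-B) *
        ⨆ j : Fin (m n), ∫⁻ ω, ⨅ k : Fin n, ‖Z n j.castSucc k ω‖ₑ ∂P) < ∞) :
    ∀ᵐ ω ∂P,
      Tendsto (fun n => empiricalMeasure (fun k => Z n (Fin.last (m n)) k ω)) atTop (𝓝 μ) := by
  obtain ⟨B, -, hB⟩ := hmin
  set K := ⨆ (n : ℕ) (_ : 2 ≤ n), (n : ℝ≥0∞) ^ (-B) *
    ⨆ j : Fin (m n), ∫⁻ ω, ⨅ k : Fin n, ‖Z n j.castSucc k ω‖ₑ ∂P with hK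
  -- The real exponent B is rounded up to a natural number, which is harmless as n ≥ 1.
  have hKn : ∀ n, 2 ≤ n → ∀ j : Fin (m n),
      ∫⁻ ω, ⨅ k, ‖Z n j.castSucc k ω‖ₑ ∂P ≤ K * (n : ℝ≥0∞) ^ ⌈B⌉₊ := by
    intro n hn j
    have hn0 : (n : ℝ≥0∞) ≠ 0 := by exact_mod_cast (by omega : n ≠ 0)
    have hnt : (n : ℝ≥0∞) ≠ ∞ := ENNReal.natCast_ne_top n
    have hn1 : (1 : ℝ≥0∞) ≤ n := by exact_mod_cast (by omega : 1 ≤ n)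
    have h1 : (n : ℝ≥0∞) ^ (-B) * ∫⁻ ω, ⨅ k, ‖Z n j.castSucc k ω‖ₑ ∂P ≤ K :=
      (mul_le_mul_right (le_iSup (fun j : Fin (m n) =>
        ∫⁻ ω, ⨅ k : Fin n, ‖Z n j.castSucc k ω‖ₑ ∂P) j) _).trans
        (le_iSup₂ (f := fun (n : ℕ) (_ : 2 ≤ n) => (n : ℝ≥0∞) ^ (-B) *
          ⨆ j : Fin (m n), ∫⁻ ω, ⨅ k : Fin n, ‖Z n j.castSucc k ω‖ₑ ∂P) n hn)
    calc ∫⁻ ω, ⨅ k, ‖Z n j.castSucc k ω‖ₑ ∂P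
        = (n : ℝ≥0∞) ^ (-B) * (∫⁻ ω, ⨅ k, ‖Z n j.castSucc k ω‖ₑ ∂P) * (n : ℝ≥0∞) ^ B := by
          rw [mul_right_comm, ← ENNReal.rpow_add _ _ hn0 hnt, neg_add_cancel, ENNReal.rpow_zero,
            one_mul]
      _ ≤ K * (n : ℝ≥0∞) ^ (⌈B⌉₊ : ℝ) :=
          mul_le_mul' h1 (ENNReal.rpow_le_rpow_of_exponent_le hn1 (Nat.le_ceil B))
      _ = _ := by rw [ENNReal.rpow_natCast]
  -- Countably many centres and rational radii leave a single null set.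
  obtain ⟨D, hDc, hD⟩ := TopologicalSpace.exists_countable_dense ℂ
  have hall : ∀ᵐ ω ∂P, ∀ c ∈ D, ∀ r : ℚ, 0 < r → Tendsto (fun n : ℕ => (n : ℝ)⁻¹ *
      (∑ k, Real.log (max r ‖Z n (Fin.last (m n)) k ω - c‖) -
        ∑ k, Real.log (max r ‖Z n 0 k ω - c‖))) atTop (𝓝 0) := by
    refine (ae_ball_iff hDc).2 fun c _ => ae_all_iff.2 fun r => ?_
    by_cases hr : 0 < r
    · exact (ae_tendsto_sum_log_max_sub P hβ hm hZ hmn hB.ne hKn c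
        (r := r) (by exact_mod_cast hr)).mono fun ω hω _ => hω
    · exact ae_of_all _ fun ω h => absurd h hr
  filter_upwards [hμ, hall] with ω h1 h2
  exact tendsto_empiricalMeasure_of_tendsto_sum_log_max hD h1 h2
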